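/- Let $(M_1,g_1)$ and $(M_2,g_2)$ be finite-dimensional smooth Riemannian manifolds without boundary, $M_1$ connected, let $\nabla^1,\nabla^2$ be their Levi-Civita connections, and suppose that $M_2$ has constant curvature $c\in\mathbb R$, i.e. its curvature tensor $R(X,Y)Z=\nabla^2_X\nabla^2_YZ-\nabla^2_Y\nabla^2_XZ-\nabla^2_{[X,Y]}Z$ satisfies $R(X,Y)Z=c\{g_2(Y,Z)X-g_2(X,Z)Y\}$. Let $F:M_1\to M_2$ be a Riemannian map, i.e. a smooth map with $g_2(F_*X,F_*Y)=g_1(X,Y)$ for all $p\in M_1$ and $X,Y\in(\ker F_{*p})^\perp$. Denote by $\nabla^F$ the connection on $F^{-1}TM_2$ pulled back from $\nabla^2$, and put $(\nabla F_*)(X,Y)=\nabla^F_X(F_*Y)-F_*(\nabla^1_XY)$ and $\tau(F)=\operatorname{trace}_{g_1}\nabla F_*$. Let $H_2$ be the mean curvature vector field of $\operatorname{range}F_*$: at $p\in M_1$, with $(e_i)$ an orthonormal basis of $(\ker F_{*p})^\perp$ extended to local vector fields, $$H_2=\frac1{\operatorname{rank}F_{*p}}\sum_i\bigl(\nabla^F_{e_i}F_*e_i\bigr)^{\perp},$$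 where $\perp$ is the component orthogonal to $\operatorname{range}F_*$ ($H_2=0$ if the rank is $0$). For a section $V$ of $F^{-1}TM_2$ orthogonal to $\operatorname{range}F_*$ write $\nabla^F_XV=-A_VF_*X+\nabla^{F\perp}_XV$ for the decomposition into the parts tangent and orthogonal to $\operatorname{range}F_*$. Assume: * $F$ is biharmonic: its bitension field $\operatorname{trace}_{g_1}\bigl(\nabla^F\nabla^F-\nabla^F_{\nabla^1}\bigr)\tau(F)-\operatorname{trace}_{g_1}R(F_*\cdot,\tau(F))F_*\cdot$ vanishes; * $F$ is pseudo-umbilical: there is $\lambda\in C^\infty(M_1)$ with $A_{H_2}F_*X=\lambda F_*X$ for all $X\in\Gamma((\ker F_*)^\perp)$; * the distribution $\ker F_*$ is minimal: its mean curvature vector field (the trace of its symmetrized second fundamental form $\tfrac12\{(\nabla^1_XY)^{(\ker F_*)^\perp}+(\nabla^1_YX)^{(\ker F_*)^\perp}\}$, $X,Y\in\Gamma(\ker F_*)$, divided by its rank, and $0$ where $\ker F_{*p}=0$) vanishes; * $H_2$ is parallel: $\nabla^{F\perp}_XH_2=0$ for all vector fields $X$ on $M_1$. Then either $F$ is harmonic,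 i.e. $\tau(F)=0$ on $M_1$, or $c=\|H_2\|^2$ at every point of $M_1$. -/

import Mathlib

open Bundle
open scoped Manifold ContDiff

noncomputable section

namespace RiemMap

section LeviCivita

variable {E : Type*} [NormedAddCommGroup E] [NormedSpace ℝ E] [FiniteDimensional ℝ E]
  {M : Type*} [TopologicalSpace M] [ChartedSpace E M]

instance instFiniteDimensionalTangentSpace (x : M) :
    FiniteDimensional ℝ (TangentSpace 𝓘(ℝ, E) x) :=
  inferInstanceAs (FiniteDimensional ℝ E)

variable [RiemannianBundle (fun x : M ↦ TangentSpace 𝓘(ℝ, E) x)]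

/-- The right-hand side of the Koszul formula at `x`, an expression in three vector fields. -/
def koszul (X Y Z : Π x : M, TangentSpace 𝓘(ℝ, E) x) (x : M) : ℝ :=
  mvfderiv 𝓘(ℝ, E) (fun q ↦ inner ℝ (Y q) (Z q)) x (X x)
    + mvfderiv 𝓘(ℝ, E) (fun q ↦ inner ℝ (X q) (Z q)) x (Y x)
    - mvfderiv 𝓘(ℝ, E) (fun q ↦ inner ℝ (X q) (Y q)) x (Z x)
    + inner ℝ (VectorField.mlieBracket 𝓘(ℝ, E) X Y x) (Z x)
    - inner ℝ (VectorField.mlieBracket 𝓘(ℝ, E) X Z x) (Y x)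
    - inner ℝ (VectorField.mlieBracket 𝓘(ℝ, E) Y Z x) (X x)

set_option linter.unusedSectionVars false

variable [IsManifold 𝓘(ℝ, E) ∞ M]
  [IsContMDiffRiemannianBundle 𝓘(ℝ, E) ∞ E (fun x : M ↦ TangentSpace 𝓘(ℝ, E) x)]

theorem mdifferentiableAt_inner {X Y : Π x : M, TangentSpace 𝓘(ℝ, E) x} {x : M}
    (hX : MDiffAt (T% X) x) (hY : MDiffAt (T% Y) x) :
    MDiffAt (fun q ↦ (inner ℝ (X q) (Y q) : ℝ)) x :=
  MDifferentiableAt.inner_bundle (F := E) (E := fun x : M ↦ TangentSpace 𝓘(ℝ, E) x)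
    (b := fun q ↦ q) (v := X) (w := Y) hX hY

theorem koszul_tensorial_left {Y Z : Π x : M, TangentSpace 𝓘(ℝ, E) x} {x : M}
    (hY : MDiffAt (T% Y) x) (hZ : MDiffAt (T% Z) x) :
    TensorialAt 𝓘(ℝ, E) E (fun X ↦ koszul X Y Z x) x where
  smul {f X} hf hX := by
    simp [koszul, inner_add_left, inner_smul_left, VectorField.mlieBracket_smul_left hf hX,
      mvfderiv_fun_mul hf (mdifferentiableAt_inner hX hY),
      mvfderiv_fun_mul hf (mdifferentiableAt_inner hX hZ), inner_smul_right]
    rw [real_inner_comm (Z x) (X x), real_inner_comm (Y x) (X x)]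
    ring
  add {X X'} hX hX' := by
    simp [koszul, inner_add_left, inner_add_right, VectorField.mlieBracket_add_left hX hX',
      mvfderiv_fun_add (mdifferentiableAt_inner hX hY) (mdifferentiableAt_inner hX' hY),
      mvfderiv_fun_add (mdifferentiableAt_inner hX hZ) (mdifferentiableAt_inner hX' hZ)]
    ring

theorem koszul_tensorial_right {X Y : Π x : M, TangentSpace 𝓘(ℝ, E) x} {x : M}
    (hX : MDiffAt (T% X) x) (hY : MDiffAt (T% Y) x) :
    TensorialAt 𝓘(ℝ, E) E (fun Z ↦ koszul X Y Z x) x where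
  smul {f Z} hf hZ := by
    simp [koszul, inner_add_left, inner_smul_left, VectorField.mlieBracket_smul_right hf hZ,
      mvfderiv_fun_mul hf (mdifferentiableAt_inner hX hZ),
      mvfderiv_fun_mul hf (mdifferentiableAt_inner hY hZ), inner_smul_right]
    rw [real_inner_comm (Z x) (X x), real_inner_comm (Z x) (Y x)]
    ring
  add {Z Z'} hZ hZ' := by
    simp [koszul, inner_add_left, inner_add_right, VectorField.mlieBracket_add_right hZ hZ',
      mvfderiv_fun_add (mdifferentiableAt_inner hX hZ) (mdifferentiableAt_inner hX hZ'),
      mvfderiv_fun_add (mdifferentiableAt_inner hY hZ) (mdifferentiableAt_inner hY hZ')]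
    ring

theorem koszul_add_mid {X Y Y' Z : Π x : M, TangentSpace 𝓘(ℝ, E) x} {x : M}
    (hX : MDiffAt (T% X) x) (hY : MDiffAt (T% Y) x) (hY' : MDiffAt (T% Y') x)
    (hZ : MDiffAt (T% Z) x) :
    koszul X (Y + Y') Z x = koszul X Y Z x + koszul X Y' Z x := by
  simp [koszul, inner_add_left, inner_add_right, VectorField.mlieBracket_add_right hY hY',
    VectorField.mlieBracket_add_left hY hY',
    mvfderiv_fun_add (mdifferentiableAt_inner hX hY) (mdifferentiableAt_inner hX hY'),
    mvfderiv_fun_add (mdifferentiableAt_inner hY hZ) (mdifferentiableAt_inner hY' hZ)]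
  ring

theorem koszul_smul_mid {X Y Z : Π x : M, TangentSpace 𝓘(ℝ, E) x} {f : M → ℝ} {x : M}
    (hX : MDiffAt (T% X) x) (hf : MDiffAt f x) (hY : MDiffAt (T% Y) x)
    (hZ : MDiffAt (T% Z) x) :
    koszul X (f • Y) Z x = f x * koszul X Y Z x
      + 2 * mvfderiv 𝓘(ℝ, E) f x (X x) * inner ℝ (Y x) (Z x) := by
  simp [koszul, inner_add_left, inner_smul_left, inner_smul_right,
    VectorField.mlieBracket_smul_right hf hY, VectorField.mlieBracket_smul_left hf hY,
    mvfderiv_fun_mul hf (mdifferentiableAt_inner hX hY),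
    mvfderiv_fun_mul hf (mdifferentiableAt_inner hY hZ)]
  rw [real_inner_comm (X x) (Y x)]
  ring

open Classical in
/-- The covariant derivative `∇Y` of the Levi-Civita connection, as a function: at a point `x` where
`Y` is differentiable, `∇_X Y` is the vector with `2 ⟪∇_X Y, Z⟫ = koszul X Y Z` for all `Z`.
(At a point where `Y` is not differentiable the value is the junk value `0`.) -/
def leviCivitaFun (Y : Π x : M, TangentSpace 𝓘(ℝ, E) x) (x : M) :
    TangentSpace 𝓘(ℝ, E) x →L[ℝ] TangentSpace 𝓘(ℝ, E) x :=
  if hY : MDiffAt (T% Y) x then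
    ∑ i, ((1 / 2 : ℝ) • TensorialAt.mkHom (I := 𝓘(ℝ, E)) (F := E)
        (fun X ↦ koszul X Y (FiberBundle.extend E
          (stdOrthonormalBasis ℝ (TangentSpace 𝓘(ℝ, E) x) i)) x) x
        (koszul_tensorial_left hY (FiberBundle.mdifferentiableAt_extend ..))).smulRight
      (stdOrthonormalBasis ℝ (TangentSpace 𝓘(ℝ, E) x) i)
  else 0

theorem two_mul_inner_leviCivitaFun {X Y Z : Π x : M, TangentSpace 𝓘(ℝ, E) x} {x : M}
    (hX : MDiffAt (T% X) x) (hY : MDiffAt (T% Y) x) (hZ : MDiffAt (T% Z) x) :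
    2 * inner ℝ (leviCivitaFun Y x (X x)) (Z x) = koszul X Y Z x := by
  have key (i) : TensorialAt.mkHom (I := 𝓘(ℝ, E)) (F := E)
        (fun X ↦ koszul X Y (FiberBundle.extend E
          (stdOrthonormalBasis ℝ (TangentSpace 𝓘(ℝ, E) x) i)) x) x
        (koszul_tensorial_left hY (FiberBundle.mdifferentiableAt_extend ..)) (X x) =
      TensorialAt.mkHom (I := 𝓘(ℝ, E)) (F := E) (fun Z ↦ koszul X Y Z x) x
        (koszul_tensorial_right hX hY) (stdOrthonormalBasis ℝ (TangentSpace 𝓘(ℝ, E) x) i) := by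
    rw [TensorialAt.mkHom_apply _ hX, TensorialAt.mkHom_apply_eq_extend]
  rw [← TensorialAt.mkHom_apply (koszul_tensorial_right hX hY) hZ]
  conv_rhs => rw [← (stdOrthonormalBasis ℝ (TangentSpace 𝓘(ℝ, E) x)).sum_repr' (Z x)]
  simp only [leviCivitaFun, dif_pos hY, sum_apply,
    ContinuousLinearMap.smulRight_apply, smul_apply, key, sum_inner, map_sum,
    map_smul, inner_smul_left, Finset.mul_sum, smul_eq_mul]
  refine Finset.sum_congr rfl fun i _ ↦ ?_
  simp
  ring

theorem eq_of_forall_section {x : M}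
    {A B : TangentSpace 𝓘(ℝ, E) x →L[ℝ] TangentSpace 𝓘(ℝ, E) x}
    (h : ∀ X Z : Π x : M, TangentSpace 𝓘(ℝ, E) x, MDiffAt (T% X) x → MDiffAt (T% Z) x →
      2 * inner ℝ (A (X x)) (Z x) = 2 * (inner ℝ (B (X x)) (Z x) : ℝ)) : A = B := by
  ext v
  refine ext_inner_right ℝ fun z ↦ ?_
  have := h (FiberBundle.extend E v) (FiberBundle.extend E z) (FiberBundle.mdifferentiableAt_extend ..)
    (FiberBundle.mdifferentiableAt_extend ..)
  simpa using this

variable (E M) in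
/-- The Levi-Civita connection of the Riemannian manifold `M`. -/
def leviCivita : CovariantDerivative 𝓘(ℝ, E) E (fun x : M ↦ TangentSpace 𝓘(ℝ, E) x) where
  toFun := leviCivitaFun
  isCovariantDerivativeOnUniv :=
    { add := fun {Y Y' x} hY hY' _ ↦ by
        refine eq_of_forall_section fun X Z hX hZ ↦ ?_
        rw [two_mul_inner_leviCivitaFun hX (mdifferentiableAt_add_section hY hY') hZ,
          koszul_add_mid hX hY hY' hZ, add_apply, inner_add_left, mul_add,
          two_mul_inner_leviCivitaFun hX hY hZ, two_mul_inner_leviCivitaFun hX hY' hZ]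
      leibniz := fun {Y f x} hY hf _ ↦ by
        refine eq_of_forall_section fun X Z hX hZ ↦ ?_
        rw [two_mul_inner_leviCivitaFun hX (hf.smul_section hY) hZ,
          koszul_smul_mid hX hf hY hZ, ← two_mul_inner_leviCivitaFun hX hY hZ]
        simp [inner_add_left, inner_smul_left]
        ring }

/-- The Levi-Civita connection is torsion-free. -/
theorem leviCivita_torsion : (leviCivita E M).torsion = 0 := by
  rw [CovariantDerivative.torsion_eq_zero_iff]
  intro X Y x hX hY
  refine ext_inner_right ℝ fun z ↦ ?_
  have hZ := FiberBundle.mdifferentiableAt_extend 𝓘(ℝ, E) E z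
  have h1 := two_mul_inner_leviCivitaFun hX hY hZ
  have h2 := two_mul_inner_leviCivitaFun hY hX hZ
  simp only [koszul, FiberBundle.extend_apply_self] at h1 h2
  rw [VectorField.mlieBracket_swap_apply (V := Y) (W := X), inner_neg_left] at h2
  simp only [real_inner_comm (X _) (Y _)] at h1 h2
  rw [inner_sub_left]
  change inner ℝ (leviCivitaFun Y x (X x)) z - inner ℝ (leviCivitaFun X x (Y x)) z = _
  linarith

/-- The Levi-Civita connection is compatible with the metric. -/
theorem leviCivita_isMetricCompatible :
    CovariantDerivative.IsMetricCompatible (V := fun x : M ↦ TangentSpace 𝓘(ℝ, E) x)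
      (leviCivita E M) := by
  rw [CovariantDerivative.isMetricCompatible_iff]
  intro x X Y Z hX hY hZ
  have h1 := two_mul_inner_leviCivitaFun hX hY hZ
  have h2 := two_mul_inner_leviCivitaFun hX hZ hY
  simp only [koszul] at h1 h2
  rw [VectorField.mlieBracket_swap_apply (V := Z) (W := Y), inner_neg_left] at h2
  simp only [real_inner_comm (Y _) (Z _)] at h1 h2
  change mvfderiv 𝓘(ℝ, E) (fun q ↦ inner ℝ (Y q) (Z q)) x (X x)
    = inner ℝ (leviCivitaFun Y x (X x)) (Z x) + inner ℝ (Y x) (leviCivitaFun Z x (X x))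
  rw [real_inner_comm (leviCivitaFun Z x (X x)) (Y x)]
  linarith

end LeviCivita

section Curvature

variable {E : Type*} [NormedAddCommGroup E] [NormedSpace ℝ E] [FiniteDimensional ℝ E]
  {M : Type*} [TopologicalSpace M] [ChartedSpace E M] [IsManifold 𝓘(ℝ, E) ∞ M]
  [RiemannianBundle (fun x : M ↦ TangentSpace 𝓘(ℝ, E) x)]
  [IsContMDiffRiemannianBundle 𝓘(ℝ, E) ∞ E (fun x : M ↦ TangentSpace 𝓘(ℝ, E) x)]

/-- The Riemann curvature tensor `R(u, v) w = ∇_U ∇_V W - ∇_V ∇_U W - ∇_[U, V] W` of the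
Levi-Civita connection; `U, V, W` are local extensions of `u, v, w` which are smooth near `x`. -/
def curvature (x : M) (u v w : TangentSpace 𝓘(ℝ, E) x) : TangentSpace 𝓘(ℝ, E) x :=
  let U : Π y : M, TangentSpace 𝓘(ℝ, E) y := FiberBundle.extend E u
  let V : Π y : M, TangentSpace 𝓘(ℝ, E) y := FiberBundle.extend E v
  let W : Π y : M, TangentSpace 𝓘(ℝ, E) y := FiberBundle.extend E w
  leviCivita E M (fun y ↦ leviCivita E M W y (V y)) x u
    - leviCivita E M (fun y ↦ leviCivita E M W y (U y)) x v
    - leviCivita E M W x (VectorField.mlieBracket 𝓘(ℝ, E) U V x)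

variable (E M) in
/-- `M` has constant curvature `c`: `R(u, v) w = c (g(v, w) u - g(u, w) v)`. -/
def IsSpaceForm (c : ℝ) : Prop :=
  ∀ (x : M) (u v w : TangentSpace 𝓘(ℝ, E) x),
    curvature x u v w = c • ((inner ℝ v w : ℝ) • u - (inner ℝ u w : ℝ) • v)

end Curvature

section Distribution

variable {E : Type*} [NormedAddCommGroup E] [NormedSpace ℝ E] [FiniteDimensional ℝ E]
  {M : Type*} [TopologicalSpace M] [ChartedSpace E M] [IsManifold 𝓘(ℝ, E) ∞ M]
  [RiemannianBundle (fun x : M ↦ TangentSpace 𝓘(ℝ, E) x)]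
  [IsContMDiffRiemannianBundle 𝓘(ℝ, E) ∞ E (fun x : M ↦ TangentSpace 𝓘(ℝ, E) x)]
  (D : Π x : M, Submodule ℝ (TangentSpace 𝓘(ℝ, E) x))

/-- The unsymmetrized second fundamental form of the distribution `D`: the component orthogonal
to `D` of `∇_{Dx} (DY)`, where `D` also denotes the orthogonal projection onto the distribution and
`Y` is a local extension of `y`. -/
def unsymmSecondFundamentalForm (p : M) (x y : TangentSpace 𝓘(ℝ, E) p) :
    TangentSpace 𝓘(ℝ, E) p :=
  (D p)ᗮ.starProjection
    (leviCivita E M (fun q ↦ (D q).starProjection (FiberBundle.extend E y q)) p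
      ((D p).starProjection x))

/-- The symmetrized second fundamental form of the distribution `D`. -/
def symmSecondFundamentalForm (p : M) (x y : TangentSpace 𝓘(ℝ, E) p) : TangentSpace 𝓘(ℝ, E) p :=
  (1 / 2 : ℝ) • (unsymmSecondFundamentalForm D p x y + unsymmSecondFundamentalForm D p y x)

/-- The mean curvature vector field of the distribution `D`: the trace of its symmetrized second
fundamental form, divided by the rank of `D`. -/
def meanCurvature (p : M) : TangentSpace 𝓘(ℝ, E) p :=
  (Module.finrank ℝ (D p) : ℝ)⁻¹ • ∑ i,
    symmSecondFundamentalForm D p (stdOrthonormalBasis ℝ (TangentSpace 𝓘(ℝ, E) p) i)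
      (stdOrthonormalBasis ℝ (TangentSpace 𝓘(ℝ, E) p) i)

/-- The distribution `D` is minimal: its mean curvature vector field vanishes. -/
def IsMinimalDistribution : Prop := ∀ p : M, meanCurvature D p = 0

end Distribution

section Maps

variable (E₁ : Type*) [NormedAddCommGroup E₁] [NormedSpace ℝ E₁] [FiniteDimensional ℝ E₁]
  {M₁ : Type*} [TopologicalSpace M₁] [ChartedSpace E₁ M₁] [IsManifold 𝓘(ℝ, E₁) ∞ M₁]
  [RiemannianBundle (fun x : M₁ ↦ TangentSpace 𝓘(ℝ, E₁) x)]
  [IsContMDiffRiemannianBundle 𝓘(ℝ, E₁) ∞ E₁ (fun x : M₁ ↦ TangentSpace 𝓘(ℝ, E₁) x)]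
  (E₂ : Type*) [NormedAddCommGroup E₂] [NormedSpace ℝ E₂] [FiniteDimensional ℝ E₂]
  {M₂ : Type*} [TopologicalSpace M₂] [ChartedSpace E₂ M₂] [IsManifold 𝓘(ℝ, E₂) ∞ M₂]
  [RiemannianBundle (fun x : M₂ ↦ TangentSpace 𝓘(ℝ, E₂) x)]
  [IsContMDiffRiemannianBundle 𝓘(ℝ, E₂) ∞ E₂ (fun x : M₂ ↦ TangentSpace 𝓘(ℝ, E₂) x)]
  (F : M₁ → M₂)

/-- The connection on the bundle `F⁻¹ TM₂` over `M₁`, pulled back from the Levi-Civita connection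
of `M₂`. In the local frame `sᵢ` of `TM₂` near `F p` given by the trivialization `e`, a section
`V = ∑ Vⁱ (sᵢ ∘ F)` along `F` has derivative `∑ dVⁱ(x) sᵢ(F p) + ∑ Vⁱ(p) (∇_{dF x} sᵢ)(F p)`
in the direction `x`; the vector field `∑ Vⁱ(p) sᵢ` is `FiberBundle.extend E₂ (V p)`. -/
def pullbackConnection (V : Π q : M₁, TangentSpace 𝓘(ℝ, E₂) (F q)) (p : M₁) :
    TangentSpace 𝓘(ℝ, E₁) p →L[ℝ] TangentSpace 𝓘(ℝ, E₂) (F p) :=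
  let e := trivializationAt E₂ (fun y : M₂ ↦ TangentSpace 𝓘(ℝ, E₂) y) (F p)
  (e.symmL ℝ (F p)).comp (mvfderiv 𝓘(ℝ, E₁) (fun q ↦ (e ⟨F q, V q⟩).2) p)
    + (leviCivita E₂ M₂ (FiberBundle.extend E₂ (V p)) (F p)).comp
        (mfderiv 𝓘(ℝ, E₁) 𝓘(ℝ, E₂) F p)

/-- The second fundamental form `(∇F_*)(x, y) = ∇_x (F_* Y) - F_* (∇_x Y)` of a map `F`, where `Y`
is a local extension of `y`. -/
def secondFundamentalForm (p : M₁) (x y : TangentSpace 𝓘(ℝ, E₁) p) :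
    TangentSpace 𝓘(ℝ, E₂) (F p) :=
  pullbackConnection E₁ E₂ F
      (fun q ↦ mfderiv 𝓘(ℝ, E₁) 𝓘(ℝ, E₂) F q (FiberBundle.extend E₁ y q)) p x
    - mfderiv 𝓘(ℝ, E₁) 𝓘(ℝ, E₂) F p (leviCivita E₁ M₁ (FiberBundle.extend E₁ y) p x)

/-- The tension field `τ(F) = trace (∇F_*)`. -/
def tensionField (p : M₁) : TangentSpace 𝓘(ℝ, E₂) (F p) :=
  ∑ i, secondFundamentalForm E₁ E₂ F p (stdOrthonormalBasis ℝ (TangentSpace 𝓘(ℝ, E₁) p) i)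
    (stdOrthonormalBasis ℝ (TangentSpace 𝓘(ℝ, E₁) p) i)

/-- `F` is harmonic: its tension field vanishes. -/
def IsHarmonicMap : Prop := ∀ p : M₁, tensionField E₁ E₂ F p = 0

/-- The Laplacian `Δ V = - trace (∇∇ - ∇_∇) V` on sections of `F⁻¹ TM₂`. -/
def laplacianAlong (V : Π q : M₁, TangentSpace 𝓘(ℝ, E₂) (F q)) (p : M₁) :
    TangentSpace 𝓘(ℝ, E₂) (F p) :=
  -∑ i, let e := stdOrthonormalBasis ℝ (TangentSpace 𝓘(ℝ, E₁) p) i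
    (pullbackConnection E₁ E₂ F
        (fun q ↦ pullbackConnection E₁ E₂ F V q (FiberBundle.extend E₁ e q)) p e
      - pullbackConnection E₁ E₂ F V p (leviCivita E₁ M₁ (FiberBundle.extend E₁ e) p e))

/-- The bitension field `τ²(F) = - Δ τ(F) - trace R(F_*, τ(F)) F_*`. -/
def bitensionField (p : M₁) : TangentSpace 𝓘(ℝ, E₂) (F p) :=
  -laplacianAlong E₁ E₂ F (tensionField E₁ E₂ F) p
    - ∑ i, let e := stdOrthonormalBasis ℝ (TangentSpace 𝓘(ℝ, E₁) p) i
      curvature (F p) (mfderiv 𝓘(ℝ, E₁) 𝓘(ℝ, E₂) F p e) (tensionField E₁ E₂ F p)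
        (mfderiv 𝓘(ℝ, E₁) 𝓘(ℝ, E₂) F p e)

/-- `F` is biharmonic: its bitension field vanishes. -/
def IsBiharmonicMap : Prop := ∀ p : M₁, bitensionField E₁ E₂ F p = 0

/-- The distribution `ker F_*` on `M₁`. -/
def kerDist (p : M₁) : Submodule ℝ (TangentSpace 𝓘(ℝ, E₁) p) :=
  LinearMap.ker (mfderiv 𝓘(ℝ, E₁) 𝓘(ℝ, E₂) F p).toLinearMap

/-- The subspaces `range F_*` of the fibres of `F⁻¹ TM₂`. -/
def rangeDist (p : M₁) : Submodule ℝ (TangentSpace 𝓘(ℝ, E₂) (F p)) :=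
  LinearMap.range (mfderiv 𝓘(ℝ, E₁) 𝓘(ℝ, E₂) F p).toLinearMap

/-- A Riemannian map: a smooth map whose differential is isometric on `(ker F_*)ᗮ` at each point. -/
structure IsRiemannianMap : Prop where
  contMDiff : ContMDiff 𝓘(ℝ, E₁) 𝓘(ℝ, E₂) ∞ F
  inner_eq : ∀ (p : M₁), ∀ x ∈ (kerDist E₁ E₂ F p)ᗮ, ∀ y ∈ (kerDist E₁ E₂ F p)ᗮ,
    (inner ℝ (mfderiv 𝓘(ℝ, E₁) 𝓘(ℝ, E₂) F p x) (mfderiv 𝓘(ℝ, E₁) 𝓘(ℝ, E₂) F p y) : ℝ)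
      = inner ℝ x y

/-- The normal connection `∇^{F⊥}`: the component orthogonal to `range F_*` of the pulled back
connection. -/
def normalConnection (V : Π q : M₁, TangentSpace 𝓘(ℝ, E₂) (F q)) (p : M₁)
    (x : TangentSpace 𝓘(ℝ, E₁) p) : TangentSpace 𝓘(ℝ, E₂) (F p) :=
  (rangeDist E₁ E₂ F p)ᗮ.starProjection (pullbackConnection E₁ E₂ F V p x)

/-- `A_V F_* x`: minus the component tangent to `range F_*` of `∇_x V`, for a section `V` of
`(range F_*)ᗮ`. -/
def shapeOperator (V : Π q : M₁, TangentSpace 𝓘(ℝ, E₂) (F q)) (p : M₁)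
    (x : TangentSpace 𝓘(ℝ, E₁) p) : TangentSpace 𝓘(ℝ, E₂) (F p) :=
  -(rangeDist E₁ E₂ F p).starProjection (pullbackConnection E₁ E₂ F V p x)

/-- The mean curvature vector field `H₂` of `range F_*`: the average, over an orthonormal basis
`eᵢ` of `(ker F_*)ᗮ`, of the components orthogonal to `range F_*` of `∇_{eᵢ} (F_* Eᵢ)`, where `Eᵢ`
is a local extension of `eᵢ`. (For a Riemannian map the `F_* eᵢ` form an orthonormal basis of
`range F_*`.) -/
def rangeMeanCurvature (p : M₁) : TangentSpace 𝓘(ℝ, E₂) (F p) :=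
  (Module.finrank ℝ (rangeDist E₁ E₂ F p) : ℝ)⁻¹ • ∑ i,
    let e : TangentSpace 𝓘(ℝ, E₁) p := stdOrthonormalBasis ℝ (kerDist E₁ E₂ F p)ᗮ i
    normalConnection E₁ E₂ F
      (fun q ↦ mfderiv 𝓘(ℝ, E₁) 𝓘(ℝ, E₂) F q (FiberBundle.extend E₁ e q)) p e

/-- `F` is pseudo-umbilical: `A_{H₂} F_* X = λ F_* X` for a smooth function `λ` and all horizontal
`X`. -/
def IsPseudoUmbilical : Prop :=
  ∃ lam : M₁ → ℝ, ContMDiff 𝓘(ℝ, E₁) 𝓘(ℝ, ℝ) ∞ lam ∧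
    ∀ (p : M₁), ∀ x ∈ (kerDist E₁ E₂ F p)ᗮ,
      shapeOperator E₁ E₂ F (rangeMeanCurvature E₁ E₂ F) p x =
        lam p • mfderiv 𝓘(ℝ, E₁) 𝓘(ℝ, E₂) F p x

/-- `H₂` is parallel with respect to the normal connection. -/
def IsParallelRangeMeanCurvature : Prop :=
  ∀ (p : M₁) (x : TangentSpace 𝓘(ℝ, E₁) p),
    normalConnection E₁ E₂ F (rangeMeanCurvature E₁ E₂ F) p x = 0

end Maps

end RiemMap

end

/-! Write `B` for the second fundamental form of `F`, `H` for the mean curvature field of the range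
and `r` for the rank. `B` is symmetric because both connections are torsion-free. Differentiating
the isometry condition makes `⟪B(x, y), F_* z⟫` skew in `y` and `z` on horizontal vectors, so
together with symmetry `B` is normal to the range there
(`IsRiemannianMap.secondFundamentalForm_mem_orthogonal`). If one argument is vertical, `B` is
tangent to the range instead (`IsRiemannianMap.secondFundamentalForm_mem_rangeDist`). Minimality of
the kernel removes the vertical part of the trace, leaving `τ = r H`
(`IsRiemannianMap.tensionField_eq`). The rank is locally constant, being the trace of the pulled
back metric.

Since `H` is parallel, `∇_x H` is tangent to the range. Pseudo-umbilicity gives `∇_x H = -λ F_* x`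
for horizontal `x`, and both sides vanish for vertical `x`
(`IsRiemannianMap.pullbackConnection_rangeMeanCurvature`). Pairing with `F_*` and tracing gives `r λ
= r ‖H‖²`. As `∇H` is tangent and `H` normal, `‖H‖²` is constant on the connected manifold. Hence
`∇τ = -r ‖H‖² F_*` with a constant coefficient, and a second derivative gives `trace ∇²τ = -r ‖H‖²
τ`. Constant curvature gives `trace R(F_*, τ) F_* = -c r τ`. The bitension field is therefore `r (c
- ‖H‖²) τ`. If it vanishes and `c ≠ ‖H‖²`, then `r = 0` or `τ = 0`, and `τ = r H` settles the first
case.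

The rest is calculus for the pulled back connection, which is defined through a trivialization. It
is reduced to the Levi-Civita connection of the target by `CMDiffAlongAt.induction` and
`pullbackConnection_comp`. -/

noncomputable section

open Filter
open scoped Topology

namespace RiemMap

set_option linter.unusedSectionVars false

/-! ### Vector fields along a map and their regularity -/

section Along

variable {E₁ : Type*} [NormedAddCommGroup E₁] [NormedSpace ℝ E₁]
  {M₁ : Type*} [TopologicalSpace M₁] [ChartedSpace E₁ M₁]
  {E₂ : Type*} [NormedAddCommGroup E₂] [NormedSpace ℝ E₂]
  {M₂ : Type*} [TopologicalSpace M₂] [ChartedSpace E₂ M₂] [IsManifold 𝓘(ℝ, E₂) ∞ M₂]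
  {F : M₁ → M₂} {V W : Π q : M₁, TangentSpace 𝓘(ℝ, E₂) (F q)} {p : M₁}

variable (E₁ E₂ F) in
/-- The vector field `V` along `F` is differentiable at `p`. -/
abbrev MDiffAlongAt (V : Π q : M₁, TangentSpace 𝓘(ℝ, E₂) (F q)) (p : M₁) : Prop :=
  MDifferentiableAt 𝓘(ℝ, E₁) (𝓘(ℝ, E₂).prod 𝓘(ℝ, E₂))
    (fun q ↦ (⟨F q, V q⟩ : TotalSpace E₂ (fun y : M₂ ↦ TangentSpace 𝓘(ℝ, E₂) y))) p

variable (E₁ E₂ F) in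
/-- The vector field `V` along `F` is of class `C^n` at `p`. -/
abbrev CMDiffAlongAt (n : ℕ∞ω) (V : Π q : M₁, TangentSpace 𝓘(ℝ, E₂) (F q)) (p : M₁) : Prop :=
  ContMDiffAt 𝓘(ℝ, E₁) (𝓘(ℝ, E₂).prod 𝓘(ℝ, E₂)) n
    (fun q ↦ (⟨F q, V q⟩ : TotalSpace E₂ (fun y : M₂ ↦ TangentSpace 𝓘(ℝ, E₂) y))) p

variable (F) in
/-- The coordinate expression of the vector field `V` along `F` in the preferred trivialization
of `TM₂` at `F p`. -/
def coordAlong (p : M₁) (V : Π q : M₁, TangentSpace 𝓘(ℝ, E₂) (F q)) (q : M₁) : E₂ :=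
  (trivializationAt E₂ (fun y : M₂ ↦ TangentSpace 𝓘(ℝ, E₂) y) (F p) ⟨F q, V q⟩).2

theorem cmdiffAlongAt_iff {n : ℕ∞ω} (hF : ContMDiffAt 𝓘(ℝ, E₁) 𝓘(ℝ, E₂) n F p) :
    CMDiffAlongAt E₁ E₂ F n V p ↔ ContMDiffAt 𝓘(ℝ, E₁) 𝓘(ℝ, E₂) n (coordAlong F p V) p :=
  contMDiffAt_totalSpace.trans (and_iff_right hF)

theorem mdiffAlongAt_iff (hF : MDifferentiableAt 𝓘(ℝ, E₁) 𝓘(ℝ, E₂) F p) :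
    MDiffAlongAt E₁ E₂ F V p ↔ MDifferentiableAt 𝓘(ℝ, E₁) 𝓘(ℝ, E₂) (coordAlong F p V) p :=
  (mdifferentiableAt_totalSpace ..).trans (and_iff_right hF)

theorem eventually_mem_baseSet (hF : ContinuousAt F p) :
    ∀ᶠ q in 𝓝 p, F q ∈ (trivializationAt E₂ (fun y : M₂ ↦ TangentSpace 𝓘(ℝ, E₂) y) (F p)).baseSet :=
  hF.eventually <| (trivializationAt E₂ (fun y : M₂ ↦ TangentSpace 𝓘(ℝ, E₂) y)
    (F p)).open_baseSet.mem_nhds (FiberBundle.mem_baseSet_trivializationAt _ _ _)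

theorem coordAlong_eq {q : M₁}
    (hq : F q ∈ (trivializationAt E₂ (fun y : M₂ ↦ TangentSpace 𝓘(ℝ, E₂) y) (F p)).baseSet) :
    coordAlong F p V q = (trivializationAt E₂ (fun y : M₂ ↦ TangentSpace 𝓘(ℝ, E₂) y)
      (F p)).continuousLinearMapAt ℝ (F q) (V q) := by
  rw [Trivialization.continuousLinearMapAt_apply, Trivialization.coe_linearMapAt_of_mem _ hq]
  rfl

theorem symmL_coordAlong {q : M₁}
    (hq : F q ∈ (trivializationAt E₂ (fun y : M₂ ↦ TangentSpace 𝓘(ℝ, E₂) y) (F p)).baseSet) :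
    (trivializationAt E₂ (fun y : M₂ ↦ TangentSpace 𝓘(ℝ, E₂) y) (F p)).symmL ℝ (F q)
      (coordAlong F p V q) = V q := by
  rw [coordAlong_eq hq, Trivialization.symmL_continuousLinearMapAt _ hq]

theorem coordAlong_add (hF : ContinuousAt F p) :
    coordAlong F p (fun q ↦ V q + W q) =ᶠ[𝓝 p] coordAlong F p V + coordAlong F p W := by
  filter_upwards [eventually_mem_baseSet (E₂ := E₂) hF] with q hq
  simp [coordAlong_eq hq]

theorem coordAlong_smul (hF : ContinuousAt F p) (f : M₁ → ℝ) :
    coordAlong F p (fun q ↦ f q • V q) =ᶠ[𝓝 p] f • coordAlong F p V := by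
  filter_upwards [eventually_mem_baseSet (E₂ := E₂) hF] with q hq
  simp [coordAlong_eq hq]

theorem CMDiffAlongAt.base {n : ℕ∞ω} (hV : CMDiffAlongAt E₁ E₂ F n V p) :
    ContMDiffAt 𝓘(ℝ, E₁) 𝓘(ℝ, E₂) n F p :=
  (contMDiffAt_totalSpace.1 hV).1

theorem MDiffAlongAt.base (hV : MDiffAlongAt E₁ E₂ F V p) :
    MDifferentiableAt 𝓘(ℝ, E₁) 𝓘(ℝ, E₂) F p :=
  ((mdifferentiableAt_totalSpace ..).1 hV).1

theorem CMDiffAlongAt.add {n : ℕ∞ω} (hV : CMDiffAlongAt E₁ E₂ F n V p)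
    (hW : CMDiffAlongAt E₁ E₂ F n W p) : CMDiffAlongAt E₁ E₂ F n (fun q ↦ V q + W q) p := by
  have hF := hV.base
  rw [cmdiffAlongAt_iff hF] at *
  exact (hV.add hW).congr_of_eventuallyEq (coordAlong_add hF.continuousAt)

theorem CMDiffAlongAt.smul {n : ℕ∞ω} {f : M₁ → ℝ} (hf : ContMDiffAt 𝓘(ℝ, E₁) 𝓘(ℝ, ℝ) n f p)
    (hV : CMDiffAlongAt E₁ E₂ F n V p) : CMDiffAlongAt E₁ E₂ F n (fun q ↦ f q • V q) p := by
  have hF := hV.base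
  rw [cmdiffAlongAt_iff hF] at *
  exact (hf.smul hV).congr_of_eventuallyEq (coordAlong_smul hF.continuousAt f)

theorem cmdiffAlongAt_zero {n : ℕ∞ω} (hF : ContMDiffAt 𝓘(ℝ, E₁) 𝓘(ℝ, E₂) n F p) :
    CMDiffAlongAt E₁ E₂ F n (fun _ ↦ 0) p := by
  rw [cmdiffAlongAt_iff hF]
  refine contMDiffAt_const (c := (0 : E₂)) |>.congr_of_eventuallyEq ?_
  filter_upwards [eventually_mem_baseSet (E₂ := E₂) hF.continuousAt] with q hq
  simp [coordAlong_eq hq]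

theorem CMDiffAlongAt.sum {n : ℕ∞ω} {ι : Type*} {s : Finset ι}
    {V : ι → Π q : M₁, TangentSpace 𝓘(ℝ, E₂) (F q)}
    (hF : ContMDiffAt 𝓘(ℝ, E₁) 𝓘(ℝ, E₂) n F p)
    (hV : ∀ i ∈ s, CMDiffAlongAt E₁ E₂ F n (V i) p) :
    CMDiffAlongAt E₁ E₂ F n (fun q ↦ ∑ i ∈ s, V i q) p := by
  classical
  induction s using Finset.induction_on with
  | empty => simpa using cmdiffAlongAt_zero hF
  | insert i s hi ih =>
    simp only [Finset.sum_insert hi]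
    exact (hV i (by simp)).add (ih fun j hj ↦ hV j (by simp [hj]))

theorem CMDiffAlongAt.congr {n : ℕ∞ω} (hV : CMDiffAlongAt E₁ E₂ F n V p)
    (h : ∀ᶠ q in 𝓝 p, W q = V q) : CMDiffAlongAt E₁ E₂ F n W p :=
  ContMDiffAt.congr_of_eventuallyEq hV (h.mono fun q hq ↦ by simp [hq])

theorem CMDiffAlongAt.comp_section {n : ℕ∞ω} (hF : ContMDiffAt 𝓘(ℝ, E₁) 𝓘(ℝ, E₂) n F p)
    {Z : Π y : M₂, TangentSpace 𝓘(ℝ, E₂) y}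
    (hZ : ContMDiffAt 𝓘(ℝ, E₂) (𝓘(ℝ, E₂).prod 𝓘(ℝ, E₂)) n (T% Z) (F p)) :
    CMDiffAlongAt E₁ E₂ F n (fun q ↦ Z (F q)) p :=
  ContMDiffAt.comp p hZ hF

theorem MDiffAlongAt.comp_section (hF : MDifferentiableAt 𝓘(ℝ, E₁) 𝓘(ℝ, E₂) F p)
    {Z : Π y : M₂, TangentSpace 𝓘(ℝ, E₂) y} (hZ : MDiffAt (T% Z) (F p)) :
    MDiffAlongAt E₁ E₂ F (fun q ↦ Z (F q)) p :=
  MDifferentiableAt.comp p hZ hF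

theorem CMDiffAlongAt.mdiffAlongAt {n : ℕ∞ω} (hV : CMDiffAlongAt E₁ E₂ F n V p) (hn : n ≠ 0) :
    MDiffAlongAt E₁ E₂ F V p :=
  ContMDiffAt.mdifferentiableAt hV hn

/-- Induction principle for vector fields along `F`. -/
theorem CMDiffAlongAt.induction [FiniteDimensional ℝ E₂] {n : ℕ∞ω}
    {P : (Π q : M₁, TangentSpace 𝓘(ℝ, E₂) (F q)) → Prop}
    (comp : ∀ Z : Π y : M₂, TangentSpace 𝓘(ℝ, E₂) y,
      (∀ k, ContMDiffAt 𝓘(ℝ, E₂) (𝓘(ℝ, E₂).prod 𝓘(ℝ, E₂)) k (T% Z) (F p)) →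
        P fun q ↦ Z (F q))
    (add : ∀ V W, CMDiffAlongAt E₁ E₂ F n V p → CMDiffAlongAt E₁ E₂ F n W p → P V → P W →
      P fun q ↦ V q + W q)
    (smul : ∀ (f : M₁ → ℝ) V, ContMDiffAt 𝓘(ℝ, E₁) 𝓘(ℝ, ℝ) n f p →
      CMDiffAlongAt E₁ E₂ F n V p → P V → P fun q ↦ f q • V q)
    (congr : ∀ V W, CMDiffAlongAt E₁ E₂ F n V p → (∀ᶠ q in 𝓝 p, W q = V q) → P V → P W)
    (hV : CMDiffAlongAt E₁ E₂ F n V p) : P V := by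
  classical
  have hF := hV.base
  -- The frame `s` has constant coordinates `b i` near `F p`, so the coefficients of `V` in `s ∘ F`
  -- are its coordinates in the trivialization.
  let b := Module.finBasis ℝ E₂
  let e := trivializationAt E₂ (fun y : M₂ ↦ TangentSpace 𝓘(ℝ, E₂) y) (F p)
  have hp := FiberBundle.mem_baseSet_trivializationAt E₂
    (fun y : M₂ ↦ TangentSpace 𝓘(ℝ, E₂) y) (F p)
  let s (i) : Π y : M₂, TangentSpace 𝓘(ℝ, E₂) y :=
    FiberBundle.extend E₂ (e.symmL ℝ (F p) (b i))
  have hs i k := FiberBundle.contMDiffAt_extend 𝓘(ℝ, E₂) E₂ (k := k) (e.symmL ℝ (F p) (b i))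
  have hcoef i : ContMDiffAt 𝓘(ℝ, E₁) 𝓘(ℝ, ℝ) n (fun q ↦ b.repr (coordAlong F p V q) i) p := by
    have h := (cmdiffAlongAt_iff hF).1 hV
    exact (LinearMap.toContinuousLinearMap (b.coord i)).contDiff.contDiffAt.contMDiffAt.comp p h
  have hterm i : CMDiffAlongAt E₁ E₂ F n
      (fun q ↦ b.repr (coordAlong F p V q) i • s i (F q)) p :=
    .smul (hcoef i) (.comp_section hF (hs i n))
  have key (t : Finset _) : P fun q ↦ ∑ i ∈ t, b.repr (coordAlong F p V q) i • s i (F q) := by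
    induction t using Finset.induction_on with
    | empty =>
      simp only [Finset.sum_empty]
      exact comp (fun _ ↦ 0) fun k ↦ contMDiff_zeroSection _ _ _
    | insert i t hi ih =>
      simp only [Finset.sum_insert hi]
      exact add _ _ (hterm i) (.sum hF fun j _ ↦ hterm j)
        (smul _ _ (hcoef i) (.comp_section hF (hs i n)) (comp _ (hs i))) ih
  refine congr _ _ (.sum hF fun j _ ↦ hterm j) ?_ (key Finset.univ)
  filter_upwards [eventually_mem_baseSet (E₂ := E₂) hF.continuousAt] with q hq
  have hsq i : s i (F q) = e.symmL ℝ (F q) (b i) := by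
    simp only [s, FiberBundle.extend]
    rw [Trivialization.symmL_apply _ hq, Trivialization.symmL_apply _ hp,
      Trivialization.apply_mk_symm _ hp]
  simp only [hsq]
  conv_lhs => rw [← symmL_coordAlong (V := V) hq, ← b.sum_repr (coordAlong F p V q), map_sum]
  simp only [map_smul]
  rfl

end Along

theorem mvfderiv_congr {E : Type*} [NormedAddCommGroup E] [NormedSpace ℝ E]
    {M : Type*} [TopologicalSpace M] [ChartedSpace E M]
    {G : Type*} [NormedAddCommGroup G] [NormedSpace ℝ G] {f g : M → G} {p : M}
    (h : f =ᶠ[𝓝 p] g) : mvfderiv 𝓘(ℝ, E) f p = mvfderiv 𝓘(ℝ, E) g p := by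
  rw [mvfderiv, mvfderiv, h.mfderiv_eq, h.self_of_nhds]

/-! ### Algebraic rules and the chain rule for the pulled back connection -/

section PullbackConnection

variable {E₁ : Type*} [NormedAddCommGroup E₁] [NormedSpace ℝ E₁] [FiniteDimensional ℝ E₁]
  {M₁ : Type*} [TopologicalSpace M₁] [ChartedSpace E₁ M₁] [IsManifold 𝓘(ℝ, E₁) ∞ M₁]
  [RiemannianBundle (fun x : M₁ ↦ TangentSpace 𝓘(ℝ, E₁) x)]
  [IsContMDiffRiemannianBundle 𝓘(ℝ, E₁) ∞ E₁ (fun x : M₁ ↦ TangentSpace 𝓘(ℝ, E₁) x)]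
  {E₂ : Type*} [NormedAddCommGroup E₂] [NormedSpace ℝ E₂] [FiniteDimensional ℝ E₂]
  {M₂ : Type*} [TopologicalSpace M₂] [ChartedSpace E₂ M₂] [IsManifold 𝓘(ℝ, E₂) ∞ M₂]
  [RiemannianBundle (fun x : M₂ ↦ TangentSpace 𝓘(ℝ, E₂) x)]
  [IsContMDiffRiemannianBundle 𝓘(ℝ, E₂) ∞ E₂ (fun x : M₂ ↦ TangentSpace 𝓘(ℝ, E₂) x)]
  {F : M₁ → M₂}

variable {V W : Π q : M₁, TangentSpace 𝓘(ℝ, E₂) (F q)} {p : M₁}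

theorem pullbackConnection_apply (V : Π q : M₁, TangentSpace 𝓘(ℝ, E₂) (F q)) (p : M₁)
    (x : TangentSpace 𝓘(ℝ, E₁) p) :
    pullbackConnection E₁ E₂ F V p x =
      (trivializationAt E₂ (fun y : M₂ ↦ TangentSpace 𝓘(ℝ, E₂) y) (F p)).symmL ℝ (F p)
        (mvfderiv 𝓘(ℝ, E₁) (coordAlong F p V) p x)
      + leviCivita E₂ M₂ (FiberBundle.extend E₂ (V p)) (F p)
        (mfderiv 𝓘(ℝ, E₁) 𝓘(ℝ, E₂) F p x) := rfl

theorem extend_add {y : M₂} (v w : TangentSpace 𝓘(ℝ, E₂) y) :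
    ∀ᶠ z in 𝓝 y, FiberBundle.extend E₂ (v + w) z =
      (FiberBundle.extend E₂ v + FiberBundle.extend E₂ w) z := by
  have hy := FiberBundle.mem_baseSet_trivializationAt E₂
    (fun y : M₂ ↦ TangentSpace 𝓘(ℝ, E₂) y) y
  filter_upwards [(Trivialization.open_baseSet _).mem_nhds hy] with z hz
  simp only [FiberBundle.extend, Pi.add_apply]
  rw [(Trivialization.linear ℝ _ hy).map_add, ← Trivialization.symmL_apply (R := ℝ) _ hz,
    ← Trivialization.symmL_apply (R := ℝ) _ hz, ← Trivialization.symmL_apply (R := ℝ) _ hz, map_add]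

theorem extend_smul {y : M₂} (a : ℝ) (v : TangentSpace 𝓘(ℝ, E₂) y) :
    ∀ᶠ z in 𝓝 y, FiberBundle.extend E₂ (a • v) z = (a • FiberBundle.extend E₂ v) z := by
  have hy := FiberBundle.mem_baseSet_trivializationAt E₂
    (fun y : M₂ ↦ TangentSpace 𝓘(ℝ, E₂) y) y
  filter_upwards [(Trivialization.open_baseSet _).mem_nhds hy] with z hz
  simp only [FiberBundle.extend, Pi.smul_apply]
  rw [(Trivialization.linear ℝ _ hy).map_smul, ← Trivialization.symmL_apply (R := ℝ) _ hz,
    ← Trivialization.symmL_apply (R := ℝ) _ hz, map_smul]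

theorem leviCivita_congr {Y Z : Π x : M₂, TangentSpace 𝓘(ℝ, E₂) x} {y : M₂}
    (hY : MDiffAt (T% Y) y) (hZ : MDiffAt (T% Z) y) (h : ∀ᶠ z in 𝓝 y, Y z = Z z) :
    leviCivita E₂ M₂ Y y = leviCivita E₂ M₂ Z y :=
  (leviCivita E₂ M₂).isCovariantDerivativeOnUniv.congr_of_eventuallyEq hY hZ univ_mem h

theorem leviCivita_add {Y Z : Π x : M₂, TangentSpace 𝓘(ℝ, E₂) x} {y : M₂}
    (hY : MDiffAt (T% Y) y) (hZ : MDiffAt (T% Z) y) :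
    leviCivita E₂ M₂ (Y + Z) y = leviCivita E₂ M₂ Y y + leviCivita E₂ M₂ Z y :=
  (leviCivita E₂ M₂).isCovariantDerivativeOnUniv.add hY hZ

theorem leviCivita_smul {f : M₂ → ℝ} {Y : Π x : M₂, TangentSpace 𝓘(ℝ, E₂) x} {y : M₂}
    (hf : MDiffAt f y) (hY : MDiffAt (T% Y) y) :
    leviCivita E₂ M₂ (f • Y) y = f y • leviCivita E₂ M₂ Y y
      + (mvfderiv 𝓘(ℝ, E₂) f y).smulRight (Y y) :=
  (leviCivita E₂ M₂).isCovariantDerivativeOnUniv.leibniz hY hf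

theorem leviCivita_extend_add {y : M₂} (v w : TangentSpace 𝓘(ℝ, E₂) y) :
    leviCivita E₂ M₂ (FiberBundle.extend E₂ (v + w)) y =
      leviCivita E₂ M₂ (FiberBundle.extend E₂ v) y
        + leviCivita E₂ M₂ (FiberBundle.extend E₂ w) y := by
  have h (v : TangentSpace 𝓘(ℝ, E₂) y) := FiberBundle.mdifferentiableAt_extend 𝓘(ℝ, E₂) E₂ v
  rw [leviCivita_congr (h _) (mdifferentiableAt_add_section (h v) (h w)) (extend_add v w),
    leviCivita_add (h v) (h w)]

theorem leviCivita_extend_smul {y : M₂} (a : ℝ) (v : TangentSpace 𝓘(ℝ, E₂) y) :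
    leviCivita E₂ M₂ (FiberBundle.extend E₂ (a • v)) y =
      a • leviCivita E₂ M₂ (FiberBundle.extend E₂ v) y := by
  have h (v : TangentSpace 𝓘(ℝ, E₂) y) := FiberBundle.mdifferentiableAt_extend 𝓘(ℝ, E₂) E₂ v
  rw [leviCivita_congr (h _) (mdifferentiableAt_const.smul_section (h v)) (extend_smul a v)]
  exact (leviCivita E₂ M₂).isCovariantDerivativeOnUniv.smul_const a (h v)

theorem pullbackConnection_congr (h : ∀ᶠ q in 𝓝 p, V q = W q) :
    pullbackConnection E₁ E₂ F V p = pullbackConnection E₁ E₂ F W p := by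
  ext x
  have h' : coordAlong F p V =ᶠ[𝓝 p] coordAlong F p W :=
    h.mono fun q hq ↦ by simp [coordAlong, hq]
  rw [pullbackConnection_apply, pullbackConnection_apply, h.self_of_nhds,
    mvfderiv_congr h']

theorem pullbackConnection_add (hV : MDiffAlongAt E₁ E₂ F V p) (hW : MDiffAlongAt E₁ E₂ F W p)
    (x : TangentSpace 𝓘(ℝ, E₁) p) :
    pullbackConnection E₁ E₂ F (fun q ↦ V q + W q) p x =
      pullbackConnection E₁ E₂ F V p x + pullbackConnection E₁ E₂ F W p x := by
  have hF := hV.base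
  rw [mdiffAlongAt_iff hF] at hV hW
  have h : mvfderiv 𝓘(ℝ, E₁) (coordAlong F p fun q ↦ V q + W q) p =
      mvfderiv 𝓘(ℝ, E₁) (coordAlong F p V) p + mvfderiv 𝓘(ℝ, E₁) (coordAlong F p W) p := by
    rw [← mvfderiv_add hV hW, mvfderiv_congr (coordAlong_add hF.continuousAt)]
  simp only [pullbackConnection_apply, h, leviCivita_extend_add, add_apply, map_add]
  abel

theorem pullbackConnection_smul {f : M₁ → ℝ} (hf : MDifferentiableAt 𝓘(ℝ, E₁) 𝓘(ℝ, ℝ) f p)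
    (hV : MDiffAlongAt E₁ E₂ F V p) (x : TangentSpace 𝓘(ℝ, E₁) p) :
    pullbackConnection E₁ E₂ F (fun q ↦ f q • V q) p x =
      f p • pullbackConnection E₁ E₂ F V p x + mvfderiv 𝓘(ℝ, E₁) f p x • V p := by
  have hF := hV.base
  rw [mdiffAlongAt_iff hF] at hV
  have h : mvfderiv 𝓘(ℝ, E₁) (coordAlong F p fun q ↦ f q • V q) p =
      f p • mvfderiv 𝓘(ℝ, E₁) (coordAlong F p V) p
        + (mvfderiv 𝓘(ℝ, E₁) f p).smulRight (coordAlong F p V p) := by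
    rw [← mvfderiv_smul hf hV, mvfderiv_congr (coordAlong_smul hF.continuousAt f)]
  have hp := FiberBundle.mem_baseSet_trivializationAt E₂
    (fun y : M₂ ↦ TangentSpace 𝓘(ℝ, E₂) y) (F p)
  simp only [pullbackConnection_apply, h, leviCivita_extend_smul, add_apply, smul_apply, map_add,
    map_smul, ContinuousLinearMap.smulRight_apply, symmL_coordAlong hp, smul_add]
  abel

/-- The pulled back connection of a vector field on the target. -/
theorem pullbackConnection_comp (hF : MDifferentiableAt 𝓘(ℝ, E₁) 𝓘(ℝ, E₂) F p)
    {Z : Π y : M₂, TangentSpace 𝓘(ℝ, E₂) y} (hZ : MDiffAt (T% Z) (F p))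
    (x : TangentSpace 𝓘(ℝ, E₁) p) :
    pullbackConnection E₁ E₂ F (fun q ↦ Z (F q)) p x =
      leviCivita E₂ M₂ Z (F p) (mfderiv 𝓘(ℝ, E₁) 𝓘(ℝ, E₂) F p x) := by
  -- The defect of the chain rule is tensorial in `Z`, because the two Leibniz terms agree. It may
  -- thus be evaluated on the field with constant coordinates through `Z (F p)`, where the
  -- coordinate derivative vanishes.
  let Φ (Z : Π y : M₂, TangentSpace 𝓘(ℝ, E₂) y) : TangentSpace 𝓘(ℝ, E₂) (F p) :=
    pullbackConnection E₁ E₂ F (fun q ↦ Z (F q)) p x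
      - leviCivita E₂ M₂ Z (F p) (mfderiv 𝓘(ℝ, E₁) 𝓘(ℝ, E₂) F p x)
  have hΦ : TensorialAt 𝓘(ℝ, E₂) E₂ Φ (F p) :=
    { smul := fun {f σ} hf hσ ↦ by
        have h1 := pullbackConnection_smul (hf.comp p hF) (.comp_section hF hσ) x
        simp only [Function.comp_apply] at h1
        simp only [Φ, Pi.smul_apply', h1, leviCivita_smul hf hσ, add_apply, smul_apply,
          ContinuousLinearMap.smulRight_apply]
        rw [show mvfderiv 𝓘(ℝ, E₁) (f ∘ F) p x = _ from mvfderiv_comp_apply p hf hF x]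
        module
      add := fun {σ σ'} hσ hσ' ↦ by
        have h1 := pullbackConnection_add (.comp_section hF hσ) (.comp_section hF hσ') x
        simp only [Φ, Pi.add_apply, h1, leviCivita_add hσ hσ', add_apply]
        abel }
  have hext := FiberBundle.mdifferentiableAt_extend 𝓘(ℝ, E₂) E₂ (Z (F p))
  have h := hΦ.pointwise hZ hext (by simp)
  rw [← sub_eq_zero]
  change Φ Z = 0
  rw [h]
  have hconst : coordAlong F p (fun q ↦ FiberBundle.extend E₂ (Z (F p)) (F q)) =ᶠ[𝓝 p]
      fun _ ↦ (trivializationAt E₂ (fun y : M₂ ↦ TangentSpace 𝓘(ℝ, E₂) y) (F p)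
        ⟨F p, Z (F p)⟩).2 := by
    filter_upwards [eventually_mem_baseSet (E₂ := E₂) hF.continuousAt] with q hq
    simp only [coordAlong, FiberBundle.extend]
    rw [Trivialization.apply_mk_symm _ hq]
  have h0 : mvfderiv 𝓘(ℝ, E₁) (coordAlong F p
      (fun q ↦ FiberBundle.extend E₂ (Z (F p)) (F q))) p = 0 := by
    rw [mvfderiv_congr hconst, mvfderiv_const]
  simp only [Φ, pullbackConnection_apply, h0]
  simp

end PullbackConnection

/-! ### Compatibility of the pulled back connection with the metric -/

section Metric

variable {E₁ : Type*} [NormedAddCommGroup E₁] [NormedSpace ℝ E₁] [FiniteDimensional ℝ E₁]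
  {M₁ : Type*} [TopologicalSpace M₁] [ChartedSpace E₁ M₁] [IsManifold 𝓘(ℝ, E₁) ∞ M₁]
  [RiemannianBundle (fun x : M₁ ↦ TangentSpace 𝓘(ℝ, E₁) x)]
  [IsContMDiffRiemannianBundle 𝓘(ℝ, E₁) ∞ E₁ (fun x : M₁ ↦ TangentSpace 𝓘(ℝ, E₁) x)]
  {E₂ : Type*} [NormedAddCommGroup E₂] [NormedSpace ℝ E₂] [FiniteDimensional ℝ E₂]
  {M₂ : Type*} [TopologicalSpace M₂] [ChartedSpace E₂ M₂] [IsManifold 𝓘(ℝ, E₂) ∞ M₂]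
  [RiemannianBundle (fun x : M₂ ↦ TangentSpace 𝓘(ℝ, E₂) x)]
  [IsContMDiffRiemannianBundle 𝓘(ℝ, E₂) ∞ E₂ (fun x : M₂ ↦ TangentSpace 𝓘(ℝ, E₂) x)]
  {F : M₁ → M₂}

variable {V W V' : Π q : M₁, TangentSpace 𝓘(ℝ, E₂) (F q)} {p : M₁}

/-- The product rule at `p` for the inner product of two vector fields along `F`. -/
def InnerProductRule (F : M₁ → M₂) (V W : Π q : M₁, TangentSpace 𝓘(ℝ, E₂) (F q)) (p : M₁)
    (x : TangentSpace 𝓘(ℝ, E₁) p) : Prop :=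
  mvfderiv 𝓘(ℝ, E₁) (fun q ↦ (inner ℝ (V q) (W q) : ℝ)) p x =
    inner ℝ (pullbackConnection E₁ E₂ F V p x) (W p)
      + inner ℝ (V p) (pullbackConnection E₁ E₂ F W p x)

theorem InnerProductRule.symm {x : TangentSpace 𝓘(ℝ, E₁) p} (h : InnerProductRule F V W p x) :
    InnerProductRule F W V p x := by
  simp only [InnerProductRule] at *
  rw [add_comm, real_inner_comm _ (W p), real_inner_comm _ (pullbackConnection E₁ E₂ F W p x), ← h]
  simp only [real_inner_comm]

theorem mdifferentiableAt_inner_along (hV : MDiffAlongAt E₁ E₂ F V p)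
    (hW : MDiffAlongAt E₁ E₂ F W p) :
    MDifferentiableAt 𝓘(ℝ, E₁) 𝓘(ℝ, ℝ) (fun q ↦ (inner ℝ (V q) (W q) : ℝ)) p :=
  MDifferentiableAt.inner_bundle (F := E₂) (E := fun y : M₂ ↦ TangentSpace 𝓘(ℝ, E₂) y) hV hW

theorem InnerProductRule.add {x : TangentSpace 𝓘(ℝ, E₁) p} (hV : MDiffAlongAt E₁ E₂ F V p)
    (hV' : MDiffAlongAt E₁ E₂ F V' p) (hW : MDiffAlongAt E₁ E₂ F W p)
    (h : InnerProductRule F V W p x) (h' : InnerProductRule F V' W p x) :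
    InnerProductRule F (fun q ↦ V q + V' q) W p x := by
  simp only [InnerProductRule] at *
  simp only [pullbackConnection_add hV hV', inner_add_left, add_apply,
    mvfderiv_fun_add (mdifferentiableAt_inner_along hV hW) (mdifferentiableAt_inner_along hV' hW),
    h, h']
  ring

theorem InnerProductRule.smul {x : TangentSpace 𝓘(ℝ, E₁) p} {f : M₁ → ℝ}
    (hf : MDifferentiableAt 𝓘(ℝ, E₁) 𝓘(ℝ, ℝ) f p) (hV : MDiffAlongAt E₁ E₂ F V p)
    (hW : MDiffAlongAt E₁ E₂ F W p) (h : InnerProductRule F V W p x) :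
    InnerProductRule F (fun q ↦ f q • V q) W p x := by
  simp only [InnerProductRule] at *
  simp only [pullbackConnection_smul hf hV, inner_add_left, real_inner_smul_left, add_apply,
    mvfderiv_fun_mul hf (mdifferentiableAt_inner_along hV hW), smul_apply, smul_eq_mul, h]
  ring

theorem InnerProductRule.congr {x : TangentSpace 𝓘(ℝ, E₁) p} (hVV' : ∀ᶠ q in 𝓝 p, V' q = V q)
    (h : InnerProductRule F V W p x) : InnerProductRule F V' W p x := by
  simp only [InnerProductRule] at *
  have h1 : (fun q ↦ (inner ℝ (V' q) (W q) : ℝ)) =ᶠ[𝓝 p] fun q ↦ inner ℝ (V q) (W q) :=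
    hVV'.mono fun q hq ↦ by simp [hq]
  rw [pullbackConnection_congr hVV', hVV'.self_of_nhds, ← h, mvfderiv_congr h1]

/-- The pulled back connection is compatible with the metric. -/
theorem mvfderiv_inner_along (hV : CMDiffAlongAt E₁ E₂ F 1 V p) (hW : CMDiffAlongAt E₁ E₂ F 1 W p)
    (x : TangentSpace 𝓘(ℝ, E₁) p) :
    mvfderiv 𝓘(ℝ, E₁) (fun q ↦ (inner ℝ (V q) (W q) : ℝ)) p x =
      inner ℝ (pullbackConnection E₁ E₂ F V p x) (W p)
        + inner ℝ (V p) (pullbackConnection E₁ E₂ F W p x) := by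
  have hF := hV.base.mdifferentiableAt one_ne_zero
  have hm {V} (hV : CMDiffAlongAt E₁ E₂ F 1 V p) : MDiffAlongAt E₁ E₂ F V p :=
    hV.mdiffAlongAt one_ne_zero
  change InnerProductRule F V W p x
  -- Both arguments are reduced in turn to fields `Z ∘ F`. The swap puts `W` in the first slot for
  -- the second induction, after which metric compatibility on the target suffices.
  refine hV.induction (P := fun V ↦ InnerProductRule F V W p x) (fun Z hZ ↦ .symm ?_)
    (fun V V' hV hV' h h' ↦ h.add (hm hV) (hm hV') (hm hW) h')
    (fun f V hf hV h ↦ h.smul (hf.mdifferentiableAt one_ne_zero) (hm hV) (hm hW))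
    (fun V V' _ hVV' h ↦ h.congr hVV')
  have hZ1 := (hZ 1).mdifferentiableAt one_ne_zero
  have hZF := MDiffAlongAt.comp_section hF hZ1
  refine hW.induction (P := fun W ↦ InnerProductRule F W (fun q ↦ Z (F q)) p x) (fun Y hY ↦ ?_)
    (fun V V' hV hV' h h' ↦ h.add (hm hV) (hm hV') hZF h')
    (fun f V hf hV h ↦ h.smul (hf.mdifferentiableAt one_ne_zero) (hm hV) hZF)
    (fun V V' _ hVV' h ↦ h.congr hVV')
  have hY1 := (hY 1).mdifferentiableAt one_ne_zero
  rw [InnerProductRule, pullbackConnection_comp hF hZ1, pullbackConnection_comp hF hY1]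
  have hcomp := mvfderiv_comp_apply p (mdifferentiableAt_inner hY1 hZ1) hF x
  refine hcomp.trans ?_
  have := (leviCivita_isMetricCompatible (E := E₂) (M := M₂)).mvfderiv_inner_eq
    (FiberBundle.extend E₂ (mfderiv 𝓘(ℝ, E₁) 𝓘(ℝ, E₂) F p x)) hY1 hZ1
  simpa using this

end Metric

/-! ### Regularity of directional derivatives -/

section Regularity

variable {E : Type*} [NormedAddCommGroup E] [NormedSpace ℝ E]
  {M : Type*} [TopologicalSpace M] [ChartedSpace E M] [IsManifold 𝓘(ℝ, E) ∞ M]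
  {G : Type*} [NormedAddCommGroup G] [NormedSpace ℝ G]

/-- In the trivialization at `p` this is an operator-valued `C^m` map applied to a `C^m` vector. The
change of coordinates on the operator cancels the one on `X`. -/
theorem contMDiffAt_mvfderiv_apply {m n : ℕ∞ω} {f : M → G} {X : Π q : M, TangentSpace 𝓘(ℝ, E) q}
    {p : M} (hf : ContMDiffAt 𝓘(ℝ, E) 𝓘(ℝ, G) n f p)
    (hX : ContMDiffAt 𝓘(ℝ, E) (𝓘(ℝ, E).prod 𝓘(ℝ, E)) m (T% X) p) (hmn : m + 1 ≤ n) :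
    ContMDiffAt 𝓘(ℝ, E) 𝓘(ℝ, G) m (fun q ↦ mvfderiv 𝓘(ℝ, E) f q (X q)) p := by
  have h1 := hf.mfderiv_const hmn
  have h2 := (contMDiffAt_section (F := E) (E := fun q : M ↦ TangentSpace 𝓘(ℝ, E) q) p).1 hX
  refine (h1.clm_apply h2).congr_of_eventuallyEq ?_
  have hp := FiberBundle.mem_baseSet_trivializationAt E
    (fun y : M ↦ TangentSpace 𝓘(ℝ, E) y) p
  filter_upwards [(Trivialization.open_baseSet _).mem_nhds hp] with q hq
  simp only [inTangentCoordinates, ContinuousLinearMap.inCoordinates, id]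
  rw [ContinuousLinearMap.comp_apply, ContinuousLinearMap.comp_apply]
  have h3 : (trivializationAt E (fun y : M ↦ TangentSpace 𝓘(ℝ, E) y) p).symmL ℝ q
      (trivializationAt E (fun y : M ↦ TangentSpace 𝓘(ℝ, E) y) p ⟨q, X q⟩).2 = X q := by
    rw [Trivialization.symmL_apply _ hq, Trivialization.symm_apply_apply_mk _ hq]
  erw [h3, TangentBundle.continuousLinearMapAt_model_space]
  rfl

end Regularity

/-! ### Regularity of `F_* X` -/

section Differential

variable {E₁ : Type*} [NormedAddCommGroup E₁] [NormedSpace ℝ E₁] [FiniteDimensional ℝ E₁]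
  {M₁ : Type*} [TopologicalSpace M₁] [ChartedSpace E₁ M₁] [IsManifold 𝓘(ℝ, E₁) ∞ M₁]
  [RiemannianBundle (fun x : M₁ ↦ TangentSpace 𝓘(ℝ, E₁) x)]
  [IsContMDiffRiemannianBundle 𝓘(ℝ, E₁) ∞ E₁ (fun x : M₁ ↦ TangentSpace 𝓘(ℝ, E₁) x)]
  {E₂ : Type*} [NormedAddCommGroup E₂] [NormedSpace ℝ E₂] [FiniteDimensional ℝ E₂]
  {M₂ : Type*} [TopologicalSpace M₂] [ChartedSpace E₂ M₂] [IsManifold 𝓘(ℝ, E₂) ∞ M₂]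
  [RiemannianBundle (fun x : M₂ ↦ TangentSpace 𝓘(ℝ, E₂) x)]
  [IsContMDiffRiemannianBundle 𝓘(ℝ, E₂) ∞ E₂ (fun x : M₂ ↦ TangentSpace 𝓘(ℝ, E₂) x)]
  {F : M₁ → M₂}

variable {p : M₁}

/-- As a map into the total space, the field is the tangent map of `F` composed with the section
`X`. -/
theorem cmdiffAlongAt_mfderiv {n : ℕ∞} (hF : ContMDiff 𝓘(ℝ, E₁) 𝓘(ℝ, E₂) ∞ F)
    {X : Π q : M₁, TangentSpace 𝓘(ℝ, E₁) q}
    (hX : ContMDiffAt 𝓘(ℝ, E₁) (𝓘(ℝ, E₁).prod 𝓘(ℝ, E₁)) n (T% X) p) :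
    CMDiffAlongAt E₁ E₂ F n (fun q ↦ mfderiv 𝓘(ℝ, E₁) 𝓘(ℝ, E₂) F q (X q)) p := by
  have h : ContMDiff _ _ n (tangentMap 𝓘(ℝ, E₁) 𝓘(ℝ, E₂) F) :=
    hF.contMDiff_tangentMap (by exact_mod_cast le_top)
  exact h.contMDiffAt.comp p hX

theorem mdiffAlongAt_mfderiv (hF : ContMDiff 𝓘(ℝ, E₁) 𝓘(ℝ, E₂) ∞ F)
    {X : Π q : M₁, TangentSpace 𝓘(ℝ, E₁) q} (hX : MDiffAt (T% X) p) :
    MDiffAlongAt E₁ E₂ F (fun q ↦ mfderiv 𝓘(ℝ, E₁) 𝓘(ℝ, E₂) F q (X q)) p := by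
  have h : ContMDiff _ _ 1 (tangentMap 𝓘(ℝ, E₁) 𝓘(ℝ, E₂) F) :=
    hF.contMDiff_tangentMap (by norm_cast)
  exact (h.contMDiffAt.mdifferentiableAt one_ne_zero).comp p hX

end Differential

/-! ### Fields with constant coordinates in a chart -/

section CoordinateFields

variable {E : Type*} [NormedAddCommGroup E] [NormedSpace ℝ E]
  {M : Type*} [TopologicalSpace M] [ChartedSpace E M] [IsManifold 𝓘(ℝ, E) ∞ M]

/-- The coordinates of a tangent vector at `p` in the preferred chart at `p`. -/
def chartCoord {p : M} (u : TangentSpace 𝓘(ℝ, E) p) : E :=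
  (trivializationAt E (fun y : M ↦ TangentSpace 𝓘(ℝ, E) y) p ⟨p, u⟩).2

theorem chartCoord_eq {p : M} (u : TangentSpace 𝓘(ℝ, E) p) :
    chartCoord u = mfderiv 𝓘(ℝ, E) 𝓘(ℝ, E) (extChartAt 𝓘(ℝ, E) p) p u := by
  have hp : p ∈ (chartAt E p).source := mem_chart_source E p
  have hp' := FiberBundle.mem_baseSet_trivializationAt E
    (fun y : M ↦ TangentSpace 𝓘(ℝ, E) y) p
  have h := DFunLike.congr_fun
    (TangentBundle.continuousLinearMapAt_trivializationAt (I := 𝓘(ℝ, E)) hp) u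
  refine Eq.trans ?_ h
  rw [Trivialization.continuousLinearMapAt_apply]
  exact (congrFun (Trivialization.coe_linearMapAt_of_mem _ hp') u).symm

/-- In the preferred chart at `p`, the field `FiberBundle.extend E u` is constant. -/
theorem extend_eq_mfderiv_symm {p q : M} (hq : q ∈ (chartAt E p).source)
    (u : TangentSpace 𝓘(ℝ, E) p) :
    FiberBundle.extend E u q = mfderiv 𝓘(ℝ, E) 𝓘(ℝ, E) (extChartAt 𝓘(ℝ, E) p).symm
      (extChartAt 𝓘(ℝ, E) p q) (chartCoord u : E) := by
  have h := TangentBundle.symmL_trivializationAt (I := 𝓘(ℝ, E)) hq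
  rw [show Set.range 𝓘(ℝ, E) = Set.univ by simp, mfderivWithin_univ] at h
  refine Eq.trans ?_ (DFunLike.congr_fun h (chartCoord u))
  exact (Trivialization.symmL_apply _ (by simpa using hq) _).symm

/-- Pulled back to the chart at `p`, both fields are constant. For such extensions torsion-freeness
reduces to a symmetry of the covariant derivative. -/
theorem mlieBracket_extend_extend [CompleteSpace E] {p : M} (u v : TangentSpace 𝓘(ℝ, E) p) :
    VectorField.mlieBracket 𝓘(ℝ, E) (FiberBundle.extend E u) (FiberBundle.extend E v) p = 0 := by
  let A (u : TangentSpace 𝓘(ℝ, E) p) : E → E :=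
    VectorField.mpullbackWithin 𝓘(ℝ, E) 𝓘(ℝ, E) (extChartAt 𝓘(ℝ, E) p).symm
      (FiberBundle.extend E u) Set.univ
  have key (u : TangentSpace 𝓘(ℝ, E) p) :
      A u =ᶠ[𝓝 (extChartAt 𝓘(ℝ, E) p p)] fun _ ↦ chartCoord u := by
    filter_upwards [extChartAt_target_mem_nhds (I := 𝓘(ℝ, E)) p] with z hz
    have hz' := (extChartAt 𝓘(ℝ, E) p).map_target hz
    have hinv := isInvertible_mfderivWithin_extChartAt_symm hz
    rw [show Set.range 𝓘(ℝ, E) = Set.univ by simp, mfderivWithin_univ] at hinv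
    simp only [A]
    rw [VectorField.mpullbackWithin_apply, mfderivWithin_univ,
      extend_eq_mfderiv_symm (by simpa using hz'), (extChartAt 𝓘(ℝ, E) p).right_inv hz]
    exact hinv.inverse_apply_eq.2 rfl
  have h0 : VectorField.lieBracketWithin ℝ (A u) (A v) Set.univ (extChartAt 𝓘(ℝ, E) p p) = 0 := by
    rw [VectorField.lieBracketWithin_univ, (key u).lieBracket_vectorField_eq (key v)]
    simp [VectorField.lieBracket_eq]
  rw [VectorField.mlieBracket, VectorField.mlieBracketWithin_apply]
  simp only [show Set.range 𝓘(ℝ, E) = Set.univ by simp, Set.preimage_univ, Set.inter_univ]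
  exact (congrArg _ h0).trans (map_zero _)

end CoordinateFields

/-! ### Symmetry and tensoriality of the second fundamental form -/

section Symmetry

variable {E₁ : Type*} [NormedAddCommGroup E₁] [NormedSpace ℝ E₁] [FiniteDimensional ℝ E₁]
  {M₁ : Type*} [TopologicalSpace M₁] [ChartedSpace E₁ M₁] [IsManifold 𝓘(ℝ, E₁) ∞ M₁]
  [RiemannianBundle (fun x : M₁ ↦ TangentSpace 𝓘(ℝ, E₁) x)]
  [IsContMDiffRiemannianBundle 𝓘(ℝ, E₁) ∞ E₁ (fun x : M₁ ↦ TangentSpace 𝓘(ℝ, E₁) x)]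
  {E₂ : Type*} [NormedAddCommGroup E₂] [NormedSpace ℝ E₂] [FiniteDimensional ℝ E₂]
  {M₂ : Type*} [TopologicalSpace M₂] [ChartedSpace E₂ M₂] [IsManifold 𝓘(ℝ, E₂) ∞ M₂]
  [RiemannianBundle (fun x : M₂ ↦ TangentSpace 𝓘(ℝ, E₂) x)]
  [IsContMDiffRiemannianBundle 𝓘(ℝ, E₂) ∞ E₂ (fun x : M₂ ↦ TangentSpace 𝓘(ℝ, E₂) x)]
  {F : M₁ → M₂}

variable {p : M₁}

/-- The chain rule in charts, applied to a field with constant coordinates. One further derivative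
then produces the Hessian of the chart representative. -/
theorem coordAlong_mfderiv_extend (hF : ContMDiff 𝓘(ℝ, E₁) 𝓘(ℝ, E₂) ∞ F)
    (y : TangentSpace 𝓘(ℝ, E₁) p) :
    coordAlong F p (fun q ↦ mfderiv 𝓘(ℝ, E₁) 𝓘(ℝ, E₂) F q (FiberBundle.extend E₁ y q)) =ᶠ[𝓝 p]
      fun q ↦ fderiv ℝ (extChartAt 𝓘(ℝ, E₂) (F p) ∘ F ∘ (extChartAt 𝓘(ℝ, E₁) p).symm)
        (extChartAt 𝓘(ℝ, E₁) p q) (chartCoord y) := by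
  have h1 : ∀ᶠ q in 𝓝 p, F q ∈ (chartAt E₂ (F p)).source :=
    hF.continuous.continuousAt.eventually
      ((chartAt E₂ (F p)).open_source.mem_nhds (mem_chart_source E₂ (F p)))
  filter_upwards [(chartAt E₁ p).open_source.mem_nhds (mem_chart_source E₁ p), h1,
    eventually_mem_baseSet (E₂ := E₂) (F := F) hF.continuous.continuousAt] with q hq hFq hb
  rw [coordAlong_eq hb, TangentBundle.continuousLinearMapAt_trivializationAt hFq,
    extend_eq_mfderiv_symm hq]
  have hq' : (extChartAt 𝓘(ℝ, E₁) p).symm (extChartAt 𝓘(ℝ, E₁) p q) = q :=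
    (extChartAt 𝓘(ℝ, E₁) p).left_inv (by simpa using hq)
  have hz : extChartAt 𝓘(ℝ, E₁) p q ∈ (extChartAt 𝓘(ℝ, E₁) p).target :=
    (extChartAt 𝓘(ℝ, E₁) p).map_source (by simpa using hq)
  have hd1 : MDifferentiableAt 𝓘(ℝ, E₁) 𝓘(ℝ, E₁) (extChartAt 𝓘(ℝ, E₁) p).symm
      (extChartAt 𝓘(ℝ, E₁) p q) := by
    have := mdifferentiableWithinAt_extChartAt_symm hz
    rwa [show Set.range 𝓘(ℝ, E₁) = Set.univ by simp, mdifferentiableWithinAt_univ] at this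
  have hd2 : MDifferentiableAt 𝓘(ℝ, E₁) 𝓘(ℝ, E₂) F q := hF.contMDiffAt.mdifferentiableAt (by simp)
  have hd3 : MDifferentiableAt 𝓘(ℝ, E₂) 𝓘(ℝ, E₂) (extChartAt 𝓘(ℝ, E₂) (F p)) (F q) :=
    mdifferentiableAt_extChartAt hFq
  have hc := mfderiv_comp_of_eq (hd3.comp q hd2) hd1 hq'
  -- The base point is generalized because the tangent spaces depend on it, which obstructs
  -- rewriting by `hq'` directly.
  have hc' : ∀ (q' : M₁) (v : E₁), q' = q →
      (mfderiv 𝓘(ℝ, E₁) 𝓘(ℝ, E₂) (extChartAt 𝓘(ℝ, E₂) (F p) ∘ F) q' v : E₂) =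
        mfderiv 𝓘(ℝ, E₂) 𝓘(ℝ, E₂) (extChartAt 𝓘(ℝ, E₂) (F p)) (F q)
          (mfderiv 𝓘(ℝ, E₁) 𝓘(ℝ, E₂) F q v) := by
    rintro q' v rfl
    exact DFunLike.congr_fun (mfderiv_comp_of_eq hd3 hd2 rfl) v
  rw [← mfderiv_eq_fderiv]
  exact ((DFunLike.congr_fun hc (chartCoord y : E₁)).trans (hc' _ _ hq')).symm

/-- The coordinate part is a second derivative of the chart representative, hence symmetric. The
connection part is symmetric because the target connection is torsion-free and fields with constant
coordinates commute. -/
theorem pullbackConnection_mfderiv_extend_comm (hF : ContMDiff 𝓘(ℝ, E₁) 𝓘(ℝ, E₂) ∞ F)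
    (x y : TangentSpace 𝓘(ℝ, E₁) p) :
    pullbackConnection E₁ E₂ F
        (fun q ↦ mfderiv 𝓘(ℝ, E₁) 𝓘(ℝ, E₂) F q (FiberBundle.extend E₁ y q)) p x =
      pullbackConnection E₁ E₂ F
        (fun q ↦ mfderiv 𝓘(ℝ, E₁) 𝓘(ℝ, E₂) F q (FiberBundle.extend E₁ x q)) p y := by
  let G := extChartAt 𝓘(ℝ, E₂) (F p) ∘ F ∘ (extChartAt 𝓘(ℝ, E₁) p).symm
  have hG : ContDiffAt ℝ 2 G (extChartAt 𝓘(ℝ, E₁) p p) := by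
    have := (contMDiffAt_iff.1 (hF.contMDiffAt (x := p))).2
    rw [show Set.range 𝓘(ℝ, E₁) = Set.univ by simp, contDiffWithinAt_univ] at this
    exact this.of_le (ENat.LEInfty.out)
  have hG' : DifferentiableAt ℝ (fderiv ℝ G) (extChartAt 𝓘(ℝ, E₁) p p) :=
    (hG.fderiv_right (m := 1) (by norm_num)).differentiableAt one_ne_zero
  have key (x y : TangentSpace 𝓘(ℝ, E₁) p) : mvfderiv 𝓘(ℝ, E₁) (coordAlong F p
      (fun q ↦ mfderiv 𝓘(ℝ, E₁) 𝓘(ℝ, E₂) F q (FiberBundle.extend E₁ y q))) p x =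
        fderiv ℝ (fderiv ℝ G) (extChartAt 𝓘(ℝ, E₁) p p) (chartCoord x) (chartCoord y) := by
    rw [mvfderiv_congr (coordAlong_mfderiv_extend hF y)]
    have hd : DifferentiableAt ℝ (fun z ↦ fderiv ℝ G z (chartCoord y))
        (extChartAt 𝓘(ℝ, E₁) p p) := hG'.clm_apply (differentiableAt_const _)
    have := mfderiv_comp_apply p hd.mdifferentiableAt
      (mdifferentiableAt_extChartAt (I := 𝓘(ℝ, E₁)) (mem_chart_source E₁ p)) x
    refine this.trans ?_
    rw [← chartCoord_eq, mfderiv_eq_fderiv,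
      fderiv_clm_apply hG' (differentiableAt_const _)]
    simp
    rfl
  have hsymm : IsSymmSndFDerivAt ℝ G (extChartAt 𝓘(ℝ, E₁) p p) := hG.isSymmSndFDerivAt (by simp)
  have htor := (CovariantDerivative.torsion_eq_zero_iff (cov := leviCivita E₂ M₂)).1
    (leviCivita_torsion (E := E₂) (M := M₂))
    (FiberBundle.mdifferentiableAt_extend 𝓘(ℝ, E₂) E₂ (mfderiv 𝓘(ℝ, E₁) 𝓘(ℝ, E₂) F p x))
    (FiberBundle.mdifferentiableAt_extend 𝓘(ℝ, E₂) E₂ (mfderiv 𝓘(ℝ, E₁) 𝓘(ℝ, E₂) F p y))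
  rw [mlieBracket_extend_extend, sub_eq_zero] at htor
  simp only [FiberBundle.extend_apply_self] at htor
  rw [pullbackConnection_apply, pullbackConnection_apply, key, key, hsymm.eq]
  simp only [FiberBundle.extend_apply_self]
  rw [htor]

/-- The second fundamental form of a map is symmetric. -/
theorem secondFundamentalForm_comm (hF : ContMDiff 𝓘(ℝ, E₁) 𝓘(ℝ, E₂) ∞ F)
    (x y : TangentSpace 𝓘(ℝ, E₁) p) :
    secondFundamentalForm E₁ E₂ F p x y = secondFundamentalForm E₁ E₂ F p y x := by
  have htor := (CovariantDerivative.torsion_eq_zero_iff (cov := leviCivita E₁ M₁)).1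
    (leviCivita_torsion (E := E₁) (M := M₁))
    (FiberBundle.mdifferentiableAt_extend 𝓘(ℝ, E₁) E₁ x)
    (FiberBundle.mdifferentiableAt_extend 𝓘(ℝ, E₁) E₁ y)
  rw [mlieBracket_extend_extend, sub_eq_zero] at htor
  simp only [FiberBundle.extend_apply_self] at htor
  rw [secondFundamentalForm, secondFundamentalForm, pullbackConnection_mfderiv_extend_comm hF, htor]

/-- The Leibniz terms `df(x) F_* Y` of the two summands cancel. This gives linearity in the second
argument and frees the form from the chosen extension. -/
theorem tensorialAt_secondFundamentalForm (hF : ContMDiff 𝓘(ℝ, E₁) 𝓘(ℝ, E₂) ∞ F)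
    (x : TangentSpace 𝓘(ℝ, E₁) p) :
    TensorialAt 𝓘(ℝ, E₁) E₁ (fun Y : Π q : M₁, TangentSpace 𝓘(ℝ, E₁) q ↦
      pullbackConnection E₁ E₂ F (fun q ↦ mfderiv 𝓘(ℝ, E₁) 𝓘(ℝ, E₂) F q (Y q)) p x
        - mfderiv 𝓘(ℝ, E₁) 𝓘(ℝ, E₂) F p (leviCivita E₁ M₁ Y p x)) p where
  smul {f Y} hf hY := by
    have h := pullbackConnection_smul hf (mdiffAlongAt_mfderiv hF hY) x
    simp only [Pi.smul_apply', map_smul, h, leviCivita_smul hf hY, add_apply, smul_apply,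
      ContinuousLinearMap.smulRight_apply, map_add]
    module
  add {Y Y'} hY hY' := by
    have h := pullbackConnection_add (mdiffAlongAt_mfderiv hF hY) (mdiffAlongAt_mfderiv hF hY') x
    simp only [Pi.add_apply, map_add, h, leviCivita_add hY hY', add_apply]
    abel

/-- `(∇F_*)(x, Y) = ∇_x (F_* Y) - F_* (∇_x Y)` for any vector field `Y`. -/
theorem secondFundamentalForm_eq (hF : ContMDiff 𝓘(ℝ, E₁) 𝓘(ℝ, E₂) ∞ F)
    {Y : Π q : M₁, TangentSpace 𝓘(ℝ, E₁) q} (hY : MDiffAt (T% Y) p)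
    (x : TangentSpace 𝓘(ℝ, E₁) p) :
    secondFundamentalForm E₁ E₂ F p x (Y p) =
      pullbackConnection E₁ E₂ F (fun q ↦ mfderiv 𝓘(ℝ, E₁) 𝓘(ℝ, E₂) F q (Y q)) p x
        - mfderiv 𝓘(ℝ, E₁) 𝓘(ℝ, E₂) F p (leviCivita E₁ M₁ Y p x) :=
  TensorialAt.mkHom_apply (tensorialAt_secondFundamentalForm hF x) hY

/-- The second fundamental form of a map as a bilinear map. -/
def secondFundamentalFormₗ (hF : ContMDiff 𝓘(ℝ, E₁) 𝓘(ℝ, E₂) ∞ F) (p : M₁) :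
    TangentSpace 𝓘(ℝ, E₁) p →ₗ[ℝ] TangentSpace 𝓘(ℝ, E₁) p →ₗ[ℝ] TangentSpace 𝓘(ℝ, E₂) (F p) :=
  LinearMap.mk₂ ℝ (secondFundamentalForm E₁ E₂ F p)
    (fun x x' y ↦ by simp only [secondFundamentalForm, map_add]; abel)
    (fun a x y ↦ by simp only [secondFundamentalForm, map_smul, smul_sub])
    (fun x y y' ↦ (TensorialAt.mkHom _ _ (tensorialAt_secondFundamentalForm hF x)).map_add y y')
    (fun a x y ↦ (TensorialAt.mkHom _ _ (tensorialAt_secondFundamentalForm hF x)).map_smul a y)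

end Symmetry

/-! ### Smooth local orthonormal frames -/

section OrthonormalFrame

variable {E : Type*} [NormedAddCommGroup E] [NormedSpace ℝ E] [FiniteDimensional ℝ E]
  {M : Type*} [TopologicalSpace M] [ChartedSpace E M] [IsManifold 𝓘(ℝ, E) ∞ M]
  [RiemannianBundle (fun x : M ↦ TangentSpace 𝓘(ℝ, E) x)]
  [IsContMDiffRiemannianBundle 𝓘(ℝ, E) ∞ E (fun x : M ↦ TangentSpace 𝓘(ℝ, E) x)]
  {p : M}

theorem contMDiffAt_inner {n : ℕ∞ω} [IsContMDiffRiemannianBundle 𝓘(ℝ, E) n E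
      (fun x : M ↦ TangentSpace 𝓘(ℝ, E) x)] {X Y : Π q : M, TangentSpace 𝓘(ℝ, E) q}
    (hX : CMDiffAt n (T% X) p) (hY : CMDiffAt n (T% Y) p) :
    CMDiffAt n (fun q ↦ (inner ℝ (X q) (Y q) : ℝ)) p :=
  ContMDiffAt.inner_bundle (F := E) (E := fun x : M ↦ TangentSpace 𝓘(ℝ, E) x)
    (b := fun q ↦ q) (v := X) (w := Y) hX hY

/-- Strong induction along the Gram-Schmidt recursion; independence at `p` keeps the denominators
away from zero there. -/
theorem contMDiffAt_gramSchmidt {N : ℕ} {s : Fin N → Π q : M, TangentSpace 𝓘(ℝ, E) q}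
    (hs : ∀ i, CMDiffAt ∞ (T% (s i)) p) (hli : LinearIndependent ℝ (s · p)) (j : Fin N) :
    CMDiffAt ∞ (T% fun q ↦ InnerProductSpace.gramSchmidt ℝ (s · q) j) p := by
  induction j using WellFoundedLT.induction with
  | ind j ih =>
    have heq (q : M) : InnerProductSpace.gramSchmidt ℝ (s · q) j = s j q -
        ∑ i ∈ Finset.Iio j, (inner ℝ (InnerProductSpace.gramSchmidt ℝ (s · q) i) (s j q) *
          (inner ℝ (InnerProductSpace.gramSchmidt ℝ (s · q) i)
            (InnerProductSpace.gramSchmidt ℝ (s · q) i))⁻¹ : ℝ) •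
              InnerProductSpace.gramSchmidt ℝ (s · q) i := by
      rw [InnerProductSpace.gramSchmidt_def]
      congr 1
      refine Finset.sum_congr rfl fun i _ ↦ ?_
      rw [Submodule.starProjection_singleton, real_inner_self_eq_norm_sq, div_eq_mul_inv]
      rfl
    refine ContMDiffAt.congr_of_eventuallyEq ?_
      (.of_forall fun q ↦ congrArg (fun v ↦ (⟨q, v⟩ : TangentBundle 𝓘(ℝ, E) M)) (heq q))
    refine (hs j).sub_section (.sum_section fun i hi ↦ ?_)
    have hi' := ih i (Finset.mem_Iio.1 hi)
    refine ContMDiffAt.smul_section (.mul (contMDiffAt_inner hi' (hs j)) ?_) hi'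
    refine (contMDiffAt_inner hi' hi').inv₀ ?_
    rw [inner_self_ne_zero]
    exact InnerProductSpace.gramSchmidt_ne_zero i hli

variable (p) in
/-- There are smooth local orthonormal frames. -/
theorem exists_orthonormalFrame :
    ∃ e : Fin (Module.finrank ℝ E) → Π q : M, TangentSpace 𝓘(ℝ, E) q,
      (∀ i, CMDiffAt ∞ (T% (e i)) p) ∧
      ∀ᶠ q in 𝓝 p, ∃ b : OrthonormalBasis (Fin (Module.finrank ℝ E)) ℝ (TangentSpace 𝓘(ℝ, E) q),
        ∀ i, b i = e i q := by
  let t := trivializationAt E (fun y : M ↦ TangentSpace 𝓘(ℝ, E) y) p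
  have hp : p ∈ t.baseSet := FiberBundle.mem_baseSet_trivializationAt _ _ _
  let s := t.localFrame (Module.finBasis ℝ E)
  have hframe := t.isLocalFrameOn_localFrame_baseSet 𝓘(ℝ, E) ∞ (Module.finBasis ℝ E)
  have hs i : CMDiffAt ∞ (T% (s i)) p := hframe.contMDiffAt t.open_baseSet hp i
  refine ⟨fun i q ↦ InnerProductSpace.gramSchmidtNormed ℝ (s · q) i, fun i ↦ ?_, ?_⟩
  · have hli := hframe.linearIndependent hp
    have h := contMDiffAt_gramSchmidt hs hli i
    refine ContMDiffAt.smul_section (f := fun q ↦ (‖InnerProductSpace.gramSchmidt ℝ (s · q) i‖)⁻¹)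
      ?_ h
    have hne := InnerProductSpace.gramSchmidt_ne_zero (𝕜 := ℝ) i hli
    refine ContMDiffAt.inv₀ ?_ (norm_ne_zero_iff.2 hne)
    simp only [norm_eq_sqrt_real_inner]
    exact (Real.contDiffAt_sqrt (inner_self_ne_zero.2 hne)).contMDiffAt.comp p
      (contMDiffAt_inner h h)
  · filter_upwards [t.open_baseSet.mem_nhds hp] with q hq
    refine ⟨InnerProductSpace.gramSchmidtOrthonormalBasis
      (show Module.finrank ℝ E = Fintype.card (Fin (Module.finrank ℝ E)) by simp) (s · q),
      fun i ↦ ?_⟩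
    refine InnerProductSpace.gramSchmidtOrthonormalBasis_apply _ ?_
    have hne := InnerProductSpace.gramSchmidt_ne_zero (𝕜 := ℝ) i (hframe.linearIndependent hq)
    simpa [InnerProductSpace.gramSchmidtNormed] using! hne

end OrthonormalFrame

/-! ### Regularity of the Levi-Civita connection -/

section Regularity

variable {E : Type*} [NormedAddCommGroup E] [NormedSpace ℝ E] [FiniteDimensional ℝ E]
  {M : Type*} [TopologicalSpace M] [ChartedSpace E M] [IsManifold 𝓘(ℝ, E) ∞ M]
  [RiemannianBundle (fun x : M ↦ TangentSpace 𝓘(ℝ, E) x)]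
  [IsContMDiffRiemannianBundle 𝓘(ℝ, E) ∞ E (fun x : M ↦ TangentSpace 𝓘(ℝ, E) x)]
  {p : M} {X Y Z : Π q : M, TangentSpace 𝓘(ℝ, E) q}

theorem contMDiffAt_koszul (hX : CMDiffAt 2 (T% X) p) (hY : CMDiffAt 2 (T% Y) p)
    (hZ : CMDiffAt 2 (T% Z) p) : CMDiffAt 1 (koszul X Y Z) p := by
  have hd {f : M → ℝ} {W : Π q : M, TangentSpace 𝓘(ℝ, E) q} (hf : CMDiffAt 2 f p)
      (hW : CMDiffAt 2 (T% W) p) : CMDiffAt 1 (fun q ↦ mvfderiv 𝓘(ℝ, E) f q (W q)) p :=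
    contMDiffAt_mvfderiv_apply hf (hW.of_le one_le_two) (by norm_num)
  have hb {V W : Π q : M, TangentSpace 𝓘(ℝ, E) q} (hV : CMDiffAt 2 (T% V) p)
      (hW : CMDiffAt 2 (T% W) p) : CMDiffAt 1 (T% (VectorField.mlieBracket 𝓘(ℝ, E) V W)) p := by
    have : IsManifold 𝓘(ℝ, E) (minSmoothness ℝ 2) M := by
      rw [minSmoothness_of_isRCLikeNormedField]; infer_instance
    have : IsManifold 𝓘(ℝ, E) ((2 : ℕ∞) + 1) M := .of_le (n := ∞) (by norm_cast)
    exact ContMDiffAt.mlieBracket_vectorField (m := 1) (n := 2) hV hW (by simp; norm_num)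
  have h1 {V : Π q : M, TangentSpace 𝓘(ℝ, E) q} (hV : CMDiffAt 2 (T% V) p) :=
    hV.of_le one_le_two
  exact ((((((hd (contMDiffAt_inner hY hZ) hX).add (hd (contMDiffAt_inner hX hZ) hY)).sub
    (hd (contMDiffAt_inner hX hY) hZ)).add (contMDiffAt_inner (hb hX hY) (h1 hZ))).sub
    (contMDiffAt_inner (hb hX hZ) (h1 hY))).sub (contMDiffAt_inner (hb hY hZ) (h1 hX)))

/-- The components in a smooth orthonormal frame are half the Koszul expressions, which cost one
derivative. -/
theorem contMDiffAt_leviCivita (hX : CMDiffAt 2 (T% X) p) (hY : CMDiffAt 2 (T% Y) p) :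
    CMDiffAt 1 (T% fun q ↦ leviCivita E M Y q (X q)) p := by
  obtain ⟨e, he, hb⟩ := exists_orthonormalFrame (E := E) p
  have he2 i : CMDiffAt 2 (T% (e i)) p := (he i).of_le ENat.LEInfty.out
  have h : CMDiffAt 1 (T% fun q ↦ ∑ i, (2⁻¹ * koszul X Y (e i) q) • e i q) p :=
    .sum_section fun i _ ↦ .smul_section
      (contMDiffAt_const.mul (contMDiffAt_koszul hX hY (he2 i))) ((he2 i).of_le one_le_two)
  refine h.congr_of_eventuallyEq ?_
  have hev {V : Π q : M, TangentSpace 𝓘(ℝ, E) q} (hV : CMDiffAt 2 (T% V) p) :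
      ∀ᶠ q in 𝓝 p, MDiffAt (T% V) q :=
    ((contMDiffAt_iff_contMDiffAt_nhds (by simp)).1 hV).mono fun q hq ↦ hq.mdifferentiableAt (by simp)
  filter_upwards [hb, hev hX, hev hY, eventually_all.2 fun i ↦ hev (he2 i)]
    with q ⟨b, hb⟩ hXq hYq heq
  have hk i : inner ℝ (e i q) (leviCivita E M Y q (X q)) = 2⁻¹ * koszul X Y (e i) q := by
    rw [← two_mul_inner_leviCivitaFun hXq hYq (heq i), real_inner_comm]
    exact (inv_mul_cancel_left₀ two_ne_zero _).symm
  conv_lhs => rw [← b.sum_repr' (leviCivita E M Y q (X q))]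
  simp only [hb, hk]

end Regularity

/-! ### Regularity of the pulled back connection -/

section PullbackRegularity

variable {E₁ : Type*} [NormedAddCommGroup E₁] [NormedSpace ℝ E₁] [FiniteDimensional ℝ E₁]
  {M₁ : Type*} [TopologicalSpace M₁] [ChartedSpace E₁ M₁] [IsManifold 𝓘(ℝ, E₁) ∞ M₁]
  [RiemannianBundle (fun x : M₁ ↦ TangentSpace 𝓘(ℝ, E₁) x)]
  [IsContMDiffRiemannianBundle 𝓘(ℝ, E₁) ∞ E₁ (fun x : M₁ ↦ TangentSpace 𝓘(ℝ, E₁) x)]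
  {E₂ : Type*} [NormedAddCommGroup E₂] [NormedSpace ℝ E₂] [FiniteDimensional ℝ E₂]
  {M₂ : Type*} [TopologicalSpace M₂] [ChartedSpace E₂ M₂] [IsManifold 𝓘(ℝ, E₂) ∞ M₂]
  [RiemannianBundle (fun x : M₂ ↦ TangentSpace 𝓘(ℝ, E₂) x)]
  [IsContMDiffRiemannianBundle 𝓘(ℝ, E₂) ∞ E₂ (fun x : M₂ ↦ TangentSpace 𝓘(ℝ, E₂) x)]
  {F : M₁ → M₂}

variable {p : M₁} {V W : Π q : M₁, TangentSpace 𝓘(ℝ, E₂) (F q)}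
  {X : Π q : M₁, TangentSpace 𝓘(ℝ, E₁) q}

theorem CMDiffAlongAt.inner {n : ℕ∞ω} [IsContMDiffRiemannianBundle 𝓘(ℝ, E₂) n E₂
      (fun x : M₂ ↦ TangentSpace 𝓘(ℝ, E₂) x)]
    (hV : CMDiffAlongAt E₁ E₂ F n V p) (hW : CMDiffAlongAt E₁ E₂ F n W p) :
    ContMDiffAt 𝓘(ℝ, E₁) 𝓘(ℝ, ℝ) n (fun q ↦ (inner ℝ (V q) (W q) : ℝ)) p :=
  ContMDiffAt.inner_bundle (F := E₂) (E := fun y : M₂ ↦ TangentSpace 𝓘(ℝ, E₂) y) hV hW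

theorem CMDiffAlongAt.eventually_mdiffAlongAt (hV : CMDiffAlongAt E₁ E₂ F 2 V p) :
    ∀ᶠ q in 𝓝 p, MDiffAlongAt E₁ E₂ F V q :=
  ((contMDiffAt_iff_contMDiffAt_nhds (by simp)).1 hV).mono fun q hq ↦ hq.mdifferentiableAt (by simp)

/-- By induction on `V`, the essential case is `V = Z ∘ F`. There `F_* X` is expanded in an
orthonormal frame `e` of the target, giving `∑ ⟪e i, F_* X⟫ ∇_{e i} Z` along `F`. -/
theorem cmdiffAlongAt_pullbackConnection (hF : ContMDiff 𝓘(ℝ, E₁) 𝓘(ℝ, E₂) ∞ F)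
    (hV : CMDiffAlongAt E₁ E₂ F 2 V p) (hX : CMDiffAt 2 (T% X) p) :
    CMDiffAlongAt E₁ E₂ F 1 (fun q ↦ pullbackConnection E₁ E₂ F V q (X q)) p := by
  have h1 {V} (hV : CMDiffAlongAt E₁ E₂ F 2 V p) : CMDiffAlongAt E₁ E₂ F 1 V p :=
    ContMDiffAt.of_le hV one_le_two
  have hX1 : CMDiffAt 1 (T% X) p := hX.of_le one_le_two
  have hF1 : ContMDiffAt 𝓘(ℝ, E₁) 𝓘(ℝ, E₂) 1 F p := hF.contMDiffAt.of_le ENat.LEInfty.out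
  have hFd q : MDifferentiableAt 𝓘(ℝ, E₁) 𝓘(ℝ, E₂) F q := hF.contMDiffAt.mdifferentiableAt (by simp)
  refine hV.induction (P := fun V ↦ CMDiffAlongAt E₁ E₂ F 1
    (fun q ↦ pullbackConnection E₁ E₂ F V q (X q)) p) (fun Z hZ ↦ ?_)
    (fun V W hV hW h h' ↦ (h.add h').congr ?_) (fun f V hf hV h ↦ ?_)
    (fun V W hV hVW h ↦ h.congr ?_)
  · obtain ⟨e, he, hb⟩ := exists_orthonormalFrame (E := E₂) (F p)
    have he2 i : CMDiffAt 2 (T% (e i)) (F p) := (he i).of_le ENat.LEInfty.out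
    have hFX := cmdiffAlongAt_mfderiv (n := 1) hF hX1
    have hterm i : CMDiffAlongAt E₁ E₂ F 1 (fun q ↦ (inner ℝ (e i (F q))
        (mfderiv 𝓘(ℝ, E₁) 𝓘(ℝ, E₂) F q (X q)) : ℝ) • leviCivita E₂ M₂ Z (F q) (e i (F q))) p :=
      .smul ((CMDiffAlongAt.comp_section hF1 ((he2 i).of_le one_le_two)).inner hFX)
        (.comp_section (Z := fun y ↦ leviCivita E₂ M₂ Z y (e i y)) hF1
          (contMDiffAt_leviCivita (he2 i) (hZ 2)))
    refine (CMDiffAlongAt.sum (s := Finset.univ) hF1 fun i _ ↦ hterm i).congr ?_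
    have hZ' : ∀ᶠ y in 𝓝 (F p), MDiffAt (T% Z) y :=
      ((contMDiffAt_iff_contMDiffAt_nhds (by simp)).1 (hZ 2)).mono fun q hq ↦ hq.mdifferentiableAt (by simp)
    filter_upwards [hF1.continuousAt.eventually hb, hF1.continuousAt.eventually hZ']
      with q ⟨b, hb⟩ hZq
    rw [pullbackConnection_comp (hFd q) hZq]
    conv_lhs => rw [← b.sum_repr' (mfderiv 𝓘(ℝ, E₁) 𝓘(ℝ, E₂) F q (X q))]
    simp only [map_sum, map_smul, hb]
  · filter_upwards [hV.eventually_mdiffAlongAt, hW.eventually_mdiffAlongAt] with q hVq hWq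
    exact pullbackConnection_add hVq hWq _
  · have hf' : ∀ᶠ q in 𝓝 p, MDifferentiableAt 𝓘(ℝ, E₁) 𝓘(ℝ, ℝ) f q :=
      ((contMDiffAt_iff_contMDiffAt_nhds (by simp)).1 hf).mono fun q hq ↦ hq.mdifferentiableAt (by simp)
    refine CMDiffAlongAt.congr (.add (.smul (hf.of_le one_le_two) h)
      (.smul (contMDiffAt_mvfderiv_apply hf hX1 (by norm_num)) (h1 hV))) ?_
    filter_upwards [hV.eventually_mdiffAlongAt, hf'] with q hVq hfq
    exact pullbackConnection_smul hfq hVq _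
  · filter_upwards [hVW.eventually_nhds] with q hq
    rw [pullbackConnection_congr hq]

end PullbackRegularity

/-! ### Traces of bilinear maps in orthonormal bases -/

section Trace

variable {ι κ V W : Type*} [Fintype ι] [Fintype κ] [NormedAddCommGroup V] [InnerProductSpace ℝ V]
  [AddCommGroup W] [Module ℝ W]

/-- Expanding and exchanging sums leaves `∑ i, ⟪f j, e i⟫ e i = f j`. Suitable `f`, `g` and `A`
yield independence of the basis, traces over a subspace, and vanishing of mixed traces. -/
theorem sum_bilin_orthonormalBasis (B : V →ₗ[ℝ] V →ₗ[ℝ] W) (e : OrthonormalBasis ι ℝ V)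
    (f g : κ → V) (A : V →ₗ[ℝ] V) :
    ∑ i, B (∑ j, (inner ℝ (f j) (e i) : ℝ) • g j) (A (e i)) = ∑ j, B (g j) (A (f j)) := by
  simp only [map_sum, map_smul, LinearMap.sum_apply, LinearMap.smul_apply]
  rw [Finset.sum_comm]
  refine Finset.sum_congr rfl fun j _ ↦ ?_
  conv_rhs => rw [← e.sum_repr' (f j)]
  simp only [map_sum, map_smul, real_inner_comm]

theorem sum_bilin_eq_sum_bilin (B : V →ₗ[ℝ] V →ₗ[ℝ] W) (e : OrthonormalBasis ι ℝ V)
    (f : OrthonormalBasis κ ℝ V) : ∑ i, B (e i) (e i) = ∑ j, B (f j) (f j) := by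
  simpa [f.sum_repr'] using sum_bilin_orthonormalBasis B e f f LinearMap.id

variable {K : Submodule ℝ V} [K.HasOrthogonalProjection]

theorem starProjection_eq_sum_inner (f : OrthonormalBasis κ ℝ K) (v : V) :
    K.starProjection v = ∑ j, (inner ℝ (f j : V) v : ℝ) • (f j : V) := by
  rw [Submodule.starProjection_apply, f.orthogonalProjectionOnto_apply_eq_sum]
  simp

theorem sum_bilin_starProjection (B : V →ₗ[ℝ] V →ₗ[ℝ] W) (e : OrthonormalBasis ι ℝ V)
    (f : OrthonormalBasis κ ℝ K) :
    ∑ i, B (K.starProjection (e i)) (K.starProjection (e i)) = ∑ j, B (f j) (f j) := by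
  have h := sum_bilin_orthonormalBasis B e (fun j ↦ (f j : V)) (fun j ↦ (f j : V))
    K.starProjection.toLinearMap
  simpa [← starProjection_eq_sum_inner] using h

/-- The trace reduces to a basis of `K`, whose elements the projection to `Kᗮ` kills. -/
theorem sum_bilin_starProjection_orthogonal [FiniteDimensional ℝ K] (B : V →ₗ[ℝ] V →ₗ[ℝ] W)
    (e : OrthonormalBasis ι ℝ V) :
    ∑ i, B (K.starProjection (e i)) (Kᗮ.starProjection (e i)) = 0 := by
  let f := stdOrthonormalBasis ℝ K
  have h := sum_bilin_orthonormalBasis B e (fun j ↦ (f j : V)) (fun j ↦ (f j : V))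
    Kᗮ.starProjection.toLinearMap
  simpa [← starProjection_eq_sum_inner] using h

end Trace

/-! ### The tension field -/

section Tension

variable {E₁ : Type*} [NormedAddCommGroup E₁] [NormedSpace ℝ E₁] [FiniteDimensional ℝ E₁]
  {M₁ : Type*} [TopologicalSpace M₁] [ChartedSpace E₁ M₁] [IsManifold 𝓘(ℝ, E₁) ∞ M₁]
  [RiemannianBundle (fun x : M₁ ↦ TangentSpace 𝓘(ℝ, E₁) x)]
  [IsContMDiffRiemannianBundle 𝓘(ℝ, E₁) ∞ E₁ (fun x : M₁ ↦ TangentSpace 𝓘(ℝ, E₁) x)]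
  {E₂ : Type*} [NormedAddCommGroup E₂] [NormedSpace ℝ E₂] [FiniteDimensional ℝ E₂]
  {M₂ : Type*} [TopologicalSpace M₂] [ChartedSpace E₂ M₂] [IsManifold 𝓘(ℝ, E₂) ∞ M₂]
  [RiemannianBundle (fun x : M₂ ↦ TangentSpace 𝓘(ℝ, E₂) x)]
  [IsContMDiffRiemannianBundle 𝓘(ℝ, E₂) ∞ E₂ (fun x : M₂ ↦ TangentSpace 𝓘(ℝ, E₂) x)]
  {F : M₁ → M₂}

variable {p : M₁}

theorem tensionField_eq_sum (hF : ContMDiff 𝓘(ℝ, E₁) 𝓘(ℝ, E₂) ∞ F) {ι : Type*} [Fintype ι]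
    (b : OrthonormalBasis ι ℝ (TangentSpace 𝓘(ℝ, E₁) p)) :
    tensionField E₁ E₂ F p = ∑ i, secondFundamentalForm E₁ E₂ F p (b i) (b i) :=
  sum_bilin_eq_sum_bilin (secondFundamentalFormₗ hF p) _ b

/-- The bases in the definition are chosen separately at each point; independence of the basis lets
a smooth frame replace them. -/
theorem cmdiffAlongAt_tensionField (hF : ContMDiff 𝓘(ℝ, E₁) 𝓘(ℝ, E₂) ∞ F) (p : M₁) :
    CMDiffAlongAt E₁ E₂ F 1 (tensionField E₁ E₂ F) p := by
  obtain ⟨e, he, hb⟩ := exists_orthonormalFrame (E := E₁) p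
  have he2 i : CMDiffAt 2 (T% (e i)) p := (he i).of_le ENat.LEInfty.out
  have hF1 : ContMDiffAt 𝓘(ℝ, E₁) 𝓘(ℝ, E₂) 1 F p := hF.contMDiffAt.of_le ENat.LEInfty.out
  have hterm i := (cmdiffAlongAt_pullbackConnection hF
    (cmdiffAlongAt_mfderiv (n := 2) hF (he2 i)) (he2 i)).add (.smul
      (contMDiffAt_const (c := (-1 : ℝ)))
      (cmdiffAlongAt_mfderiv (n := 1) hF (contMDiffAt_leviCivita (he2 i) (he2 i))))
  refine (CMDiffAlongAt.sum (s := Finset.univ) hF1 fun i _ ↦ hterm i).congr ?_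
  have hd i : ∀ᶠ q in 𝓝 p, MDiffAt (T% (e i)) q :=
    ((contMDiffAt_iff_contMDiffAt_nhds (by simp)).1 (he2 i)).mono
      fun q hq ↦ hq.mdifferentiableAt (by simp)
  filter_upwards [hb, eventually_all.2 hd] with q ⟨b, hb⟩ hq
  rw [tensionField_eq_sum hF b]
  refine Finset.sum_congr rfl fun i _ ↦ ?_
  rw [hb, secondFundamentalForm_eq hF (hq i)]
  module

end Tension

/-! ### Horizontal projection and rank of a Riemannian map -/

section RiemannianMap

variable {E₁ : Type*} [NormedAddCommGroup E₁] [NormedSpace ℝ E₁] [FiniteDimensional ℝ E₁]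
  {M₁ : Type*} [TopologicalSpace M₁] [ChartedSpace E₁ M₁] [IsManifold 𝓘(ℝ, E₁) ∞ M₁]
  [RiemannianBundle (fun x : M₁ ↦ TangentSpace 𝓘(ℝ, E₁) x)]
  [IsContMDiffRiemannianBundle 𝓘(ℝ, E₁) ∞ E₁ (fun x : M₁ ↦ TangentSpace 𝓘(ℝ, E₁) x)]
  {E₂ : Type*} [NormedAddCommGroup E₂] [NormedSpace ℝ E₂] [FiniteDimensional ℝ E₂]
  {M₂ : Type*} [TopologicalSpace M₂] [ChartedSpace E₂ M₂] [IsManifold 𝓘(ℝ, E₂) ∞ M₂]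
  [RiemannianBundle (fun x : M₂ ↦ TangentSpace 𝓘(ℝ, E₂) x)]
  [IsContMDiffRiemannianBundle 𝓘(ℝ, E₂) ∞ E₂ (fun x : M₂ ↦ TangentSpace 𝓘(ℝ, E₂) x)]
  {F : M₁ → M₂}

variable {p : M₁}

theorem mfderiv_kerDist_starProjection (x : TangentSpace 𝓘(ℝ, E₁) p) :
    mfderiv 𝓘(ℝ, E₁) 𝓘(ℝ, E₂) F p ((kerDist E₁ E₂ F p).starProjection x) = 0 :=
  LinearMap.mem_ker.1 ((kerDist E₁ E₂ F p).starProjection_apply_mem x)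

theorem mfderiv_kerDist_orthogonal_starProjection (x : TangentSpace 𝓘(ℝ, E₁) p) :
    mfderiv 𝓘(ℝ, E₁) 𝓘(ℝ, E₂) F p ((kerDist E₁ E₂ F p)ᗮ.starProjection x) =
      mfderiv 𝓘(ℝ, E₁) 𝓘(ℝ, E₂) F p x := by
  rw [Submodule.starProjection_orthogonal_val, map_sub, mfderiv_kerDist_starProjection, sub_zero]

/-- Vertical parts are invisible to `F_*`. Equivalently, the horizontal projection is the adjoint of
`F_*` composed with `F_*`, which is the source of its regularity. -/
theorem IsRiemannianMap.inner_mfderiv (hF : IsRiemannianMap E₁ E₂ F)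
    (x y : TangentSpace 𝓘(ℝ, E₁) p) :
    (inner ℝ (mfderiv 𝓘(ℝ, E₁) 𝓘(ℝ, E₂) F p x) (mfderiv 𝓘(ℝ, E₁) 𝓘(ℝ, E₂) F p y) : ℝ) =
      inner ℝ x ((kerDist E₁ E₂ F p)ᗮ.starProjection y) := by
  rw [← mfderiv_kerDist_orthogonal_starProjection x, ← mfderiv_kerDist_orthogonal_starProjection y,
    hF.inner_eq p _ (Submodule.starProjection_apply_mem _ _) _
      (Submodule.starProjection_apply_mem _ _), Submodule.inner_starProjection_left_eq_right,
    Submodule.starProjection_eq_self_iff.2 (Submodule.starProjection_apply_mem _ _)]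

theorem finrank_kerDist_orthogonal (p : M₁) :
    Module.finrank ℝ (kerDist E₁ E₂ F p)ᗮ = Module.finrank ℝ (rangeDist E₁ E₂ F p) := by
  have h1 := (kerDist E₁ E₂ F p).finrank_add_finrank_orthogonal
  have h2 : Module.finrank ℝ (rangeDist E₁ E₂ F p) + Module.finrank ℝ (kerDist E₁ E₂ F p) =
      Module.finrank ℝ (TangentSpace 𝓘(ℝ, E₁) p) := LinearMap.finrank_range_add_finrank_ker _
  omega

/-- The trace of the pulled back metric is the rank. -/
theorem IsRiemannianMap.sum_inner_mfderiv (hF : IsRiemannianMap E₁ E₂ F) {ι : Type*} [Fintype ι]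
    (b : OrthonormalBasis ι ℝ (TangentSpace 𝓘(ℝ, E₁) p)) :
    ∑ i, (inner ℝ (mfderiv 𝓘(ℝ, E₁) 𝓘(ℝ, E₂) F p (b i)) (mfderiv 𝓘(ℝ, E₁) 𝓘(ℝ, E₂) F p (b i)) : ℝ) =
      Module.finrank ℝ (rangeDist E₁ E₂ F p) := by
  let f := stdOrthonormalBasis ℝ (kerDist E₁ E₂ F p)ᗮ
  have h := sum_bilin_starProjection (innerₗ (TangentSpace 𝓘(ℝ, E₁) p)) b f
  have h1 (i : ι) : (inner ℝ (mfderiv 𝓘(ℝ, E₁) 𝓘(ℝ, E₂) F p (b i))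
      (mfderiv 𝓘(ℝ, E₁) 𝓘(ℝ, E₂) F p (b i)) : ℝ) =
      innerₗ (TangentSpace 𝓘(ℝ, E₁) p) ((kerDist E₁ E₂ F p)ᗮ.starProjection (b i))
        ((kerDist E₁ E₂ F p)ᗮ.starProjection (b i)) := by
    rw [hF.inner_mfderiv, innerₗ_apply_apply, Submodule.inner_starProjection_left_eq_right,
      Submodule.starProjection_eq_self_iff.2 (Submodule.starProjection_apply_mem _ _)]
  have h2 j : innerₗ (TangentSpace 𝓘(ℝ, E₁) p) (f j) (f j) = 1 := by
    rw [innerₗ_apply_apply, ← Submodule.coe_inner, real_inner_self_eq_norm_sq,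
      OrthonormalBasis.norm_eq_one, one_pow]
  rw [Finset.sum_congr rfl fun i _ ↦ h1 i, h, Finset.sum_congr rfl fun j _ ↦ h2 j]
  simp [finrank_kerDist_orthogonal]

/-- The horizontal part of a vector field is as regular as the field. -/
theorem IsRiemannianMap.contMDiffAt_horizontal (hF : IsRiemannianMap E₁ E₂ F)
    {X : Π q : M₁, TangentSpace 𝓘(ℝ, E₁) q} {n : ℕ∞} (hX : CMDiffAt n (T% X) p) :
    CMDiffAt n (T% fun q ↦ (kerDist E₁ E₂ F q)ᗮ.starProjection (X q)) p := by
  obtain ⟨e, he, hb⟩ := exists_orthonormalFrame (E := E₁) p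
  have hen i : CMDiffAt n (T% (e i)) p := (he i).of_le (by exact_mod_cast le_top)
  have : IsContMDiffRiemannianBundle 𝓘(ℝ, E₂) n E₂ (fun x : M₂ ↦ TangentSpace 𝓘(ℝ, E₂) x) :=
    .of_le (n := ∞) (by exact_mod_cast le_top)
  -- The frame components of the horizontal part are `⟪F_* e i, F_* X⟫`, so no local triviality of
  -- the kernel is needed.
  have h : CMDiffAt n (T% fun q ↦ ∑ i, (inner ℝ (mfderiv 𝓘(ℝ, E₁) 𝓘(ℝ, E₂) F q (e i q))
      (mfderiv 𝓘(ℝ, E₁) 𝓘(ℝ, E₂) F q (X q)) : ℝ) • e i q) p :=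
    .sum_section fun i _ ↦ .smul_section ((cmdiffAlongAt_mfderiv hF.contMDiff (hen i)).inner
      (cmdiffAlongAt_mfderiv hF.contMDiff hX)) (hen i)
  refine h.congr_of_eventuallyEq ?_
  filter_upwards [hb] with q ⟨b, hb⟩
  conv_lhs => rw [← b.sum_repr' ((kerDist E₁ E₂ F q)ᗮ.starProjection (X q))]
  simp only [hb, hF.inner_mfderiv]

theorem IsRiemannianMap.contMDiffAt_vertical (hF : IsRiemannianMap E₁ E₂ F)
    {X : Π q : M₁, TangentSpace 𝓘(ℝ, E₁) q} {n : ℕ∞} (hX : CMDiffAt n (T% X) p) :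
    CMDiffAt n (T% fun q ↦ (kerDist E₁ E₂ F q).starProjection (X q)) p := by
  refine (hX.sub_section (hF.contMDiffAt_horizontal hX)).congr_of_eventuallyEq
    (.of_forall fun q ↦ ?_)
  simp [Submodule.starProjection_orthogonal_val]

/-- The rank of a Riemannian map is locally constant. -/
theorem IsRiemannianMap.eventually_finrank_eq (hF : IsRiemannianMap E₁ E₂ F) (p : M₁) :
    ∀ᶠ q in 𝓝 p, Module.finrank ℝ (rangeDist E₁ E₂ F q) =
      Module.finrank ℝ (rangeDist E₁ E₂ F p) := by
  obtain ⟨e, he, hb⟩ := exists_orthonormalFrame (E := E₁) p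
  have he1 i : CMDiffAt 1 (T% (e i)) p := (he i).of_le ENat.LEInfty.out
  -- The trace of the pulled back metric is continuous at `p` and equals the rank near `p`; integers
  -- at distance less than one coincide.
  let g (q : M₁) : ℝ := ∑ i, inner ℝ (mfderiv 𝓘(ℝ, E₁) 𝓘(ℝ, E₂) F q (e i q))
    (mfderiv 𝓘(ℝ, E₁) 𝓘(ℝ, E₂) F q (e i q))
  have hg : ContinuousAt g p := tendsto_finsetSum _ fun i _ ↦
    (CMDiffAlongAt.inner (cmdiffAlongAt_mfderiv (n := 1) hF.contMDiff (he1 i))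
      (cmdiffAlongAt_mfderiv (n := 1) hF.contMDiff (he1 i))).continuousAt
  have hgk : ∀ᶠ q in 𝓝 p, g q = Module.finrank ℝ (rangeDist E₁ E₂ F q) := by
    filter_upwards [hb] with q ⟨b, hb⟩
    simp only [g, ← hb, hF.sum_inner_mfderiv]
  have hlt := hg.eventually (Metric.ball_mem_nhds (g p) one_pos)
  filter_upwards [hgk, hlt] with q hq hlt
  rw [hq, hgk.self_of_nhds, Nat.dist_cast_real, Nat.dist_eq] at hlt
  rw [← Nat.cast_inj (R := ℤ), ← sub_eq_zero, ← Int.abs_lt_one_iff]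
  exact_mod_cast hlt

end RiemannianMap

/-! ### Tension field and mean curvature of the range -/

section RangeMeanCurvature

variable {E₁ : Type*} [NormedAddCommGroup E₁] [NormedSpace ℝ E₁] [FiniteDimensional ℝ E₁]
  {M₁ : Type*} [TopologicalSpace M₁] [ChartedSpace E₁ M₁] [IsManifold 𝓘(ℝ, E₁) ∞ M₁]
  [RiemannianBundle (fun x : M₁ ↦ TangentSpace 𝓘(ℝ, E₁) x)]
  [IsContMDiffRiemannianBundle 𝓘(ℝ, E₁) ∞ E₁ (fun x : M₁ ↦ TangentSpace 𝓘(ℝ, E₁) x)]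
  {E₂ : Type*} [NormedAddCommGroup E₂] [NormedSpace ℝ E₂] [FiniteDimensional ℝ E₂]
  {M₂ : Type*} [TopologicalSpace M₂] [ChartedSpace E₂ M₂] [IsManifold 𝓘(ℝ, E₂) ∞ M₂]
  [RiemannianBundle (fun x : M₂ ↦ TangentSpace 𝓘(ℝ, E₂) x)]
  [IsContMDiffRiemannianBundle 𝓘(ℝ, E₂) ∞ E₂ (fun x : M₂ ↦ TangentSpace 𝓘(ℝ, E₂) x)]
  {F : M₁ → M₂}

variable {p : M₁}

theorem IsRiemannianMap.inner_mfderiv_of_mem (hF : IsRiemannianMap E₁ E₂ F)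
    (x : TangentSpace 𝓘(ℝ, E₁) p) {y : TangentSpace 𝓘(ℝ, E₁) p} (hy : y ∈ (kerDist E₁ E₂ F p)ᗮ) :
    (inner ℝ (mfderiv 𝓘(ℝ, E₁) 𝓘(ℝ, E₂) F p x) (mfderiv 𝓘(ℝ, E₁) 𝓘(ℝ, E₂) F p y) : ℝ) =
      inner ℝ x y := by
  rw [hF.inner_mfderiv, Submodule.starProjection_eq_self_iff.2 hy]

theorem mvfderiv_inner {X Y : Π q : M₁, TangentSpace 𝓘(ℝ, E₁) q} (hX : MDiffAt (T% X) p)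
    (hY : MDiffAt (T% Y) p) (v : TangentSpace 𝓘(ℝ, E₁) p) :
    mvfderiv 𝓘(ℝ, E₁) (fun q ↦ (inner ℝ (X q) (Y q) : ℝ)) p v =
      inner ℝ (leviCivita E₁ M₁ X p v) (Y p) + inner ℝ (X p) (leviCivita E₁ M₁ Y p v) := by
  have h := (leviCivita_isMetricCompatible (E := E₁) (M := M₁)).mvfderiv_inner_eq
    (FiberBundle.extend E₁ v) hX hY
  simpa only [FiberBundle.extend_apply_self] using h

theorem pullbackConnection_zero (hF : MDifferentiableAt 𝓘(ℝ, E₁) 𝓘(ℝ, E₂) F p)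
    (x : TangentSpace 𝓘(ℝ, E₁) p) : pullbackConnection E₁ E₂ F (fun _ ↦ 0) p x = 0 := by
  have h : MDiffAlongAt E₁ E₂ F (fun q ↦ (FiberBundle.extend E₂ (0 : TangentSpace 𝓘(ℝ, E₂) (F p)) (F q))) p :=
    .comp_section hF (FiberBundle.mdifferentiableAt_extend 𝓘(ℝ, E₂) E₂ _)
  have h' := pullbackConnection_smul (f := fun _ ↦ (0 : ℝ)) mdifferentiableAt_const h x
  simpa [mvfderiv_const] using h'

/-- On horizontal vectors, `⟪(∇F_*)(x, y), F_* z⟫` is antisymmetric in `y` and `z`. -/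
theorem IsRiemannianMap.inner_secondFundamentalForm_add (hF : IsRiemannianMap E₁ E₂ F)
    (x : TangentSpace 𝓘(ℝ, E₁) p) {y z : TangentSpace 𝓘(ℝ, E₁) p}
    (hy : y ∈ (kerDist E₁ E₂ F p)ᗮ) (hz : z ∈ (kerDist E₁ E₂ F p)ᗮ) :
    (inner ℝ (secondFundamentalForm E₁ E₂ F p x y) (mfderiv 𝓘(ℝ, E₁) 𝓘(ℝ, E₂) F p z) : ℝ) +
      inner ℝ (secondFundamentalForm E₁ E₂ F p x z) (mfderiv 𝓘(ℝ, E₁) 𝓘(ℝ, E₂) F p y) = 0 := by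
  -- With horizontal extensions, `⟪F_* Y, F_* Z⟫ = ⟪Y, Z⟫` holds at every point and can be
  -- differentiated by both metric connections.
  let Y (y : TangentSpace 𝓘(ℝ, E₁) p) (q : M₁) : TangentSpace 𝓘(ℝ, E₁) q :=
    (kerDist E₁ E₂ F q)ᗮ.starProjection (FiberBundle.extend E₁ y q)
  have hY y : CMDiffAt 1 (T% (Y y)) p := hF.contMDiffAt_horizontal (n := 1)
    ((FiberBundle.contMDiffAt_extend 𝓘(ℝ, E₁) E₁ y).of_le ENat.LEInfty.out)
  have hYd y : MDiffAt (T% (Y y)) p := (hY y).mdifferentiableAt one_ne_zero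
  have hYp {y} (hy : y ∈ (kerDist E₁ E₂ F p)ᗮ) : Y y p = y := by
    simp only [Y, FiberBundle.extend_apply_self]
    exact Submodule.starProjection_eq_self_iff.2 hy
  have h1 := mvfderiv_inner_along (cmdiffAlongAt_mfderiv (n := 1) hF.contMDiff (hY y))
    (cmdiffAlongAt_mfderiv (n := 1) hF.contMDiff (hY z)) x
  have h2 : (fun q ↦ (inner ℝ (mfderiv 𝓘(ℝ, E₁) 𝓘(ℝ, E₂) F q (Y y q))
      (mfderiv 𝓘(ℝ, E₁) 𝓘(ℝ, E₂) F q (Y z q)) : ℝ)) = fun q ↦ inner ℝ (Y y q) (Y z q) :=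
    funext fun q ↦ hF.inner_mfderiv_of_mem _ (Submodule.starProjection_apply_mem _ _)
  rw [h2, mvfderiv_inner (hYd y) (hYd z), hYp hy, hYp hz] at h1
  have h3 {y} (hy : y ∈ (kerDist E₁ E₂ F p)ᗮ) := secondFundamentalForm_eq hF.contMDiff (hYd y) x
  have h4 := h3 hy
  have h5 := h3 hz
  rw [hYp hy] at h4
  rw [hYp hz] at h5
  rw [h4, h5, inner_sub_left, inner_sub_left, hF.inner_mfderiv_of_mem _ hy,
    hF.inner_mfderiv_of_mem _ hz]
  rw [real_inner_comm _ y, real_inner_comm _ (mfderiv 𝓘(ℝ, E₁) 𝓘(ℝ, E₂) F p y)] at h1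
  linarith

/-- On horizontal vectors, the second fundamental form of a Riemannian map is normal to the range of
the differential. -/
theorem IsRiemannianMap.secondFundamentalForm_mem_orthogonal (hF : IsRiemannianMap E₁ E₂ F)
    {x y : TangentSpace 𝓘(ℝ, E₁) p} (hx : x ∈ (kerDist E₁ E₂ F p)ᗮ)
    (hy : y ∈ (kerDist E₁ E₂ F p)ᗮ) :
    secondFundamentalForm E₁ E₂ F p x y ∈ (rangeDist E₁ E₂ F p)ᗮ := by
  refine (Submodule.mem_orthogonal' _ _).2 fun w hw ↦ ?_
  obtain ⟨u, rfl⟩ := LinearMap.mem_range.1 hw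
  obtain ⟨z, hz, hzu⟩ : ∃ z ∈ (kerDist E₁ E₂ F p)ᗮ,
      mfderiv 𝓘(ℝ, E₁) 𝓘(ℝ, E₂) F p z = mfderiv 𝓘(ℝ, E₁) 𝓘(ℝ, E₂) F p u :=
    ⟨_, Submodule.starProjection_apply_mem _ _, mfderiv_kerDist_orthogonal_starProjection u⟩
  refine (congrArg (inner ℝ _) hzu).symm.trans ?_
  -- A trilinear form symmetric in its first two slots and skew in its last two is zero; the three
  -- cyclic instances combine as in the Koszul formula.
  have h1 := hF.inner_secondFundamentalForm_add x hy hz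
  have h2 := hF.inner_secondFundamentalForm_add y hx hz
  have h3 := hF.inner_secondFundamentalForm_add z hx hy
  rw [secondFundamentalForm_comm hF.contMDiff y x] at h2
  rw [secondFundamentalForm_comm hF.contMDiff z x, secondFundamentalForm_comm hF.contMDiff z y] at h3
  linarith

/-- `F_*` annihilates the vertical extension identically, so only the term `-F_* ∇` survives. -/
theorem IsRiemannianMap.secondFundamentalForm_starProjection_kerDist (hF : IsRiemannianMap E₁ E₂ F)
    (x y : TangentSpace 𝓘(ℝ, E₁) p) :
    secondFundamentalForm E₁ E₂ F p x ((kerDist E₁ E₂ F p).starProjection y) =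
      -mfderiv 𝓘(ℝ, E₁) 𝓘(ℝ, E₂) F p (leviCivita E₁ M₁
        (fun q ↦ (kerDist E₁ E₂ F q).starProjection (FiberBundle.extend E₁ y q)) p x) := by
  have hY : CMDiffAt 1 (T% fun q ↦ (kerDist E₁ E₂ F q).starProjection (FiberBundle.extend E₁ y q)) p :=
    hF.contMDiffAt_vertical (n := 1)
      ((FiberBundle.contMDiffAt_extend 𝓘(ℝ, E₁) E₁ y).of_le ENat.LEInfty.out)
  have h := secondFundamentalForm_eq hF.contMDiff (hY.mdifferentiableAt one_ne_zero) x
  simp only [FiberBundle.extend_apply_self, mfderiv_kerDist_starProjection] at h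
  rw [h, pullbackConnection_zero (hF.contMDiff.contMDiffAt.mdifferentiableAt (by simp)), zero_sub]

theorem IsRiemannianMap.secondFundamentalForm_mem_rangeDist (hF : IsRiemannianMap E₁ E₂ F)
    (x : TangentSpace 𝓘(ℝ, E₁) p) {v : TangentSpace 𝓘(ℝ, E₁) p} (hv : v ∈ kerDist E₁ E₂ F p) :
    secondFundamentalForm E₁ E₂ F p x v ∈ rangeDist E₁ E₂ F p := by
  rw [← Submodule.starProjection_eq_self_iff.2 hv, hF.secondFundamentalForm_starProjection_kerDist]
  exact neg_mem (LinearMap.mem_range_self _ _)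

/-- On the diagonal, `F_*` sends the second fundamental form of the kernel to minus the vertical
part of that of `F`, so the trace is controlled by the mean curvature of the kernel. -/
theorem IsRiemannianMap.sum_secondFundamentalForm_kerDist (hF : IsRiemannianMap E₁ E₂ F)
    (hmin : IsMinimalDistribution (kerDist E₁ E₂ F)) (p : M₁) :
    ∑ i, secondFundamentalForm E₁ E₂ F p
      ((kerDist E₁ E₂ F p).starProjection (stdOrthonormalBasis ℝ (TangentSpace 𝓘(ℝ, E₁) p) i))
      ((kerDist E₁ E₂ F p).starProjection (stdOrthonormalBasis ℝ (TangentSpace 𝓘(ℝ, E₁) p) i)) =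
        0 := by
  have h := hmin p
  have hsymm (x : TangentSpace 𝓘(ℝ, E₁) p) :
      mfderiv 𝓘(ℝ, E₁) 𝓘(ℝ, E₂) F p (symmSecondFundamentalForm (kerDist E₁ E₂ F) p x x) =
        -secondFundamentalForm E₁ E₂ F p ((kerDist E₁ E₂ F p).starProjection x)
          ((kerDist E₁ E₂ F p).starProjection x) := by
    rw [symmSecondFundamentalForm, ← two_smul ℝ, smul_smul, one_div, inv_mul_cancel₀ two_ne_zero,
      one_smul, unsymmSecondFundamentalForm, mfderiv_kerDist_orthogonal_starProjection,
      hF.secondFundamentalForm_starProjection_kerDist, neg_neg]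
  rw [meanCurvature, smul_eq_zero, inv_eq_zero, Nat.cast_eq_zero] at h
  rcases h with h | h
  -- Here the inverse of the kernel rank is the default `0` and minimality says nothing, but all
  -- vertical projections vanish.
  · rw [Submodule.finrank_eq_zero] at h
    refine Finset.sum_eq_zero fun i _ ↦ ?_
    rw [hF.secondFundamentalForm_starProjection_kerDist]
    have h0 (x : TangentSpace 𝓘(ℝ, E₁) p) : (kerDist E₁ E₂ F p).starProjection x = 0 :=
      (Submodule.mem_bot ℝ).1 (h ▸ (kerDist E₁ E₂ F p).starProjection_apply_mem x)
    rw [h0, map_zero, map_zero, neg_zero]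
  · have h' := congrArg (mfderiv 𝓘(ℝ, E₁) 𝓘(ℝ, E₂) F p) h
    rw [map_sum, map_zero, Finset.sum_congr rfl fun i _ ↦ hsymm _, Finset.sum_neg_distrib,
      neg_eq_zero] at h'
    exact h'

/-- The tension field of a Riemannian map with minimal kernel is the trace of the second fundamental
form over the horizontal space. -/
theorem IsRiemannianMap.tensionField_eq_sum_horizontal (hF : IsRiemannianMap E₁ E₂ F)
    (hmin : IsMinimalDistribution (kerDist E₁ E₂ F)) (p : M₁) :
    tensionField E₁ E₂ F p = ∑ j, secondFundamentalForm E₁ E₂ F p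
      (stdOrthonormalBasis ℝ (kerDist E₁ E₂ F p)ᗮ j : TangentSpace 𝓘(ℝ, E₁) p)
      (stdOrthonormalBasis ℝ (kerDist E₁ E₂ F p)ᗮ j : TangentSpace 𝓘(ℝ, E₁) p) := by
  let B := secondFundamentalFormₗ hF.contMDiff p
  let e := stdOrthonormalBasis ℝ (TangentSpace 𝓘(ℝ, E₁) p)
  let K := kerDist E₁ E₂ F p
  have h1 := hF.sum_secondFundamentalForm_kerDist hmin p
  have h2 := sum_bilin_starProjection (K := Kᗮ) B e (stdOrthonormalBasis ℝ Kᗮ)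
  have h3 := sum_bilin_starProjection_orthogonal (K := K) B e
  have h4 : ∑ i, B (Kᗮ.starProjection (e i)) (K.starProjection (e i)) = 0 :=
    (Finset.sum_congr rfl fun i _ ↦ secondFundamentalForm_comm hF.contMDiff _ _).trans h3
  have h5 (x : TangentSpace 𝓘(ℝ, E₁) p) : B x x = B (K.starProjection x) (K.starProjection x) +
      B (K.starProjection x) (Kᗮ.starProjection x) + B (Kᗮ.starProjection x) (K.starProjection x) +
        B (Kᗮ.starProjection x) (Kᗮ.starProjection x) := by
    conv_lhs => rw [← K.starProjection_add_starProjection_orthogonal x]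
    simp only [map_add, LinearMap.add_apply]
    abel
  change ∑ i, B (e i) (e i) = ∑ j, B (stdOrthonormalBasis ℝ Kᗮ j : TangentSpace 𝓘(ℝ, E₁) p)
    (stdOrthonormalBasis ℝ Kᗮ j : TangentSpace 𝓘(ℝ, E₁) p)
  rw [Finset.sum_congr rfl fun i _ ↦ h5 (e i)]
  simp only [Finset.sum_add_distrib]
  rw [h3, h4, ← h2]
  refine (congrArg (fun t ↦ t + 0 + 0 + _) h1).trans ?_
  simp only [zero_add, add_zero]

/-- The derivative of `F_* X` differs from the second fundamental form by a vector of the range, and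
the form is already normal. -/
theorem IsRiemannianMap.normalConnection_mfderiv_extend (hF : IsRiemannianMap E₁ E₂ F)
    {x : TangentSpace 𝓘(ℝ, E₁) p} (hx : x ∈ (kerDist E₁ E₂ F p)ᗮ) :
    normalConnection E₁ E₂ F
      (fun q ↦ mfderiv 𝓘(ℝ, E₁) 𝓘(ℝ, E₂) F q (FiberBundle.extend E₁ x q)) p x =
        secondFundamentalForm E₁ E₂ F p x x := by
  have h : pullbackConnection E₁ E₂ F
      (fun q ↦ mfderiv 𝓘(ℝ, E₁) 𝓘(ℝ, E₂) F q (FiberBundle.extend E₁ x q)) p x =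
        secondFundamentalForm E₁ E₂ F p x x + mfderiv 𝓘(ℝ, E₁) 𝓘(ℝ, E₂) F p
          (leviCivita E₁ M₁ (FiberBundle.extend E₁ x) p x) := by
    rw [secondFundamentalForm, sub_add_cancel]
  have h' : (rangeDist E₁ E₂ F p).starProjection (mfderiv 𝓘(ℝ, E₁) 𝓘(ℝ, E₂) F p
      (leviCivita E₁ M₁ (FiberBundle.extend E₁ x) p x)) = mfderiv 𝓘(ℝ, E₁) 𝓘(ℝ, E₂) F p
        (leviCivita E₁ M₁ (FiberBundle.extend E₁ x) p x) :=
    Submodule.starProjection_eq_self_iff.2 (LinearMap.mem_range_self _ _)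
  rw [normalConnection, h, map_add, Submodule.starProjection_eq_self_iff.2
    (hF.secondFundamentalForm_mem_orthogonal hx hx), Submodule.starProjection_orthogonal_val, h',
    sub_self, add_zero]

theorem IsRiemannianMap.rangeMeanCurvature_eq (hF : IsRiemannianMap E₁ E₂ F)
    (hmin : IsMinimalDistribution (kerDist E₁ E₂ F)) (p : M₁) :
    rangeMeanCurvature E₁ E₂ F p =
      (Module.finrank ℝ (rangeDist E₁ E₂ F p) : ℝ)⁻¹ • tensionField E₁ E₂ F p := by
  rw [rangeMeanCurvature, hF.tensionField_eq_sum_horizontal hmin]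
  refine congrArg _ (Finset.sum_congr rfl fun j _ ↦ ?_)
  exact hF.normalConnection_mfderiv_extend (Subtype.coe_prop _)

theorem IsRiemannianMap.tensionField_eq (hF : IsRiemannianMap E₁ E₂ F)
    (hmin : IsMinimalDistribution (kerDist E₁ E₂ F)) (p : M₁) :
    tensionField E₁ E₂ F p =
      (Module.finrank ℝ (rangeDist E₁ E₂ F p) : ℝ) • rangeMeanCurvature E₁ E₂ F p := by
  rw [hF.rangeMeanCurvature_eq hmin, smul_smul]
  rcases eq_or_ne (Module.finrank ℝ (rangeDist E₁ E₂ F p)) 0 with h | h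
  -- In rank zero the inverse is the default `0`, so the tension must vanish by itself: its
  -- horizontal trace is an empty sum.
  · rw [h, Nat.cast_zero, zero_mul, zero_smul, hF.tensionField_eq_sum_horizontal hmin]
    rw [← finrank_kerDist_orthogonal] at h
    have : IsEmpty (Fin (Module.finrank ℝ (kerDist E₁ E₂ F p)ᗮ)) := by rw [h]; infer_instance
    exact Finset.sum_of_isEmpty _
  · rw [mul_inv_cancel₀ (by exact_mod_cast h), one_smul]

theorem rangeMeanCurvature_mem_orthogonal (p : M₁) :
    rangeMeanCurvature E₁ E₂ F p ∈ (rangeDist E₁ E₂ F p)ᗮ :=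
  Submodule.smul_mem _ _ (Submodule.sum_mem _ fun _ _ ↦ Submodule.starProjection_apply_mem _ _)

/-- Local constancy of the rank makes the field a constant multiple of the tension near `p`. -/
theorem IsRiemannianMap.cmdiffAlongAt_rangeMeanCurvature (hF : IsRiemannianMap E₁ E₂ F)
    (hmin : IsMinimalDistribution (kerDist E₁ E₂ F)) (p : M₁) :
    CMDiffAlongAt E₁ E₂ F 1 (rangeMeanCurvature E₁ E₂ F) p := by
  refine (CMDiffAlongAt.smul (f := fun _ ↦ (Module.finrank ℝ (rangeDist E₁ E₂ F p) : ℝ)⁻¹)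
    contMDiffAt_const (cmdiffAlongAt_tensionField hF.contMDiff p)).congr ?_
  filter_upwards [hF.eventually_finrank_eq p] with q hq
  rw [hF.rangeMeanCurvature_eq hmin, hq]

end RangeMeanCurvature

/-- In a chart, a function with zero derivative on an open set has open level sets. -/
theorem eventually_eq_of_mfderiv_eq_zero {E : Type*} [NormedAddCommGroup E] [NormedSpace ℝ E]
    {M : Type*} [TopologicalSpace M] [ChartedSpace E M] [IsManifold 𝓘(ℝ, E) 1 M]
    {f : M → ℝ} (hf : MDifferentiable 𝓘(ℝ, E) 𝓘(ℝ, ℝ) f)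
    (hf' : ∀ q, mfderiv 𝓘(ℝ, E) 𝓘(ℝ, ℝ) f q = 0) (p : M) : ∀ᶠ q in 𝓝 p, f q = f p := by
  let φ := extChartAt 𝓘(ℝ, E) p
  have hφ : IsOpen φ.target := isOpen_extChartAt_target p
  have hs {z : E} (hz : z ∈ φ.target) : MDifferentiableAt 𝓘(ℝ, E) 𝓘(ℝ, E) φ.symm z :=
    ((contMDiffOn_extChartAt_symm (n := 1) p).contMDiffAt (hφ.mem_nhds hz)).mdifferentiableAt
      one_ne_zero
  have hd : DifferentiableOn ℝ (f ∘ φ.symm) φ.target := fun z hz ↦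
    ((hf _).comp z (hs hz)).differentiableAt.differentiableWithinAt
  have hd' : φ.target.EqOn (fderiv ℝ (f ∘ φ.symm)) 0 := fun z hz ↦ by
    rw [← mfderiv_eq_fderiv, mfderiv_comp z (hf _) (hs hz), hf']
    exact ContinuousLinearMap.zero_comp _
  have ho := hφ.isOpen_inter_preimage_of_fderiv_eq_zero hd hd' {f p}
  have hp : φ p ∈ φ.target ∩ f ∘ φ.symm ⁻¹' {f p} :=
    ⟨mem_extChartAt_target p, by simp [φ]⟩
  filter_upwards [(continuousAt_extChartAt p).eventually (ho.mem_nhds hp),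
    extChartAt_source_mem_nhds (I := 𝓘(ℝ, E)) p] with q hq hq'
  exact (congrArg f (φ.left_inv hq')).symm.trans hq.2

/-! ### Derivatives of the mean curvature and the bitension field -/

section Biharmonic

variable {E₁ : Type*} [NormedAddCommGroup E₁] [NormedSpace ℝ E₁] [FiniteDimensional ℝ E₁]
  {M₁ : Type*} [TopologicalSpace M₁] [ChartedSpace E₁ M₁] [IsManifold 𝓘(ℝ, E₁) ∞ M₁]
  [RiemannianBundle (fun x : M₁ ↦ TangentSpace 𝓘(ℝ, E₁) x)]
  [IsContMDiffRiemannianBundle 𝓘(ℝ, E₁) ∞ E₁ (fun x : M₁ ↦ TangentSpace 𝓘(ℝ, E₁) x)]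
  {E₂ : Type*} [NormedAddCommGroup E₂] [NormedSpace ℝ E₂] [FiniteDimensional ℝ E₂]
  {M₂ : Type*} [TopologicalSpace M₂] [ChartedSpace E₂ M₂] [IsManifold 𝓘(ℝ, E₂) ∞ M₂]
  [RiemannianBundle (fun x : M₂ ↦ TangentSpace 𝓘(ℝ, E₂) x)]
  [IsContMDiffRiemannianBundle 𝓘(ℝ, E₂) ∞ E₂ (fun x : M₂ ↦ TangentSpace 𝓘(ℝ, E₂) x)]
  {F : M₁ → M₂}

variable {p : M₁}

/-- The Weingarten relation: differentiate `⟪H, F_* Y⟫ = 0` and drop the tangential part of `∇_x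
(F_* Y)`. -/
theorem inner_pullbackConnection_rangeMeanCurvature (hF : ContMDiff 𝓘(ℝ, E₁) 𝓘(ℝ, E₂) ∞ F)
    (hH : CMDiffAlongAt E₁ E₂ F 1 (rangeMeanCurvature E₁ E₂ F) p)
    (x y : TangentSpace 𝓘(ℝ, E₁) p) :
    (inner ℝ (pullbackConnection E₁ E₂ F (rangeMeanCurvature E₁ E₂ F) p x)
        (mfderiv 𝓘(ℝ, E₁) 𝓘(ℝ, E₂) F p y) : ℝ) =
      -inner ℝ (rangeMeanCurvature E₁ E₂ F p) (secondFundamentalForm E₁ E₂ F p x y) := by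
  have hY : CMDiffAt 1 (T% (FiberBundle.extend E₁ y)) p :=
    (FiberBundle.contMDiffAt_extend 𝓘(ℝ, E₁) E₁ y).of_le ENat.LEInfty.out
  have horth (q : M₁) (u : TangentSpace 𝓘(ℝ, E₁) q) : (inner ℝ (rangeMeanCurvature E₁ E₂ F q)
      (mfderiv 𝓘(ℝ, E₁) 𝓘(ℝ, E₂) F q u) : ℝ) = 0 :=
    (Submodule.mem_orthogonal' _ _).1 (rangeMeanCurvature_mem_orthogonal q) _
      (LinearMap.mem_range_self _ _)
  have h := mvfderiv_inner_along hH (cmdiffAlongAt_mfderiv (n := 1) hF hY) x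
  simp only [horth, mvfderiv_const, FiberBundle.extend_apply_self] at h
  rw [secondFundamentalForm, inner_sub_right, horth, sub_zero]
  have h0 : (0 : TangentSpace 𝓘(ℝ, E₁) p →L[ℝ] ℝ) x = 0 := rfl
  linarith

/-- Parallelism leaves only the tangential part, which the umbilical condition determines in
horizontal directions; vertical directions need a separate argument. -/
theorem IsRiemannianMap.pullbackConnection_rangeMeanCurvature (hF : IsRiemannianMap E₁ E₂ F)
    (hmin : IsMinimalDistribution (kerDist E₁ E₂ F)) (hpar : IsParallelRangeMeanCurvature E₁ E₂ F)
    {a : ℝ} (ha : ∀ x ∈ (kerDist E₁ E₂ F p)ᗮ,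
      shapeOperator E₁ E₂ F (rangeMeanCurvature E₁ E₂ F) p x =
        a • mfderiv 𝓘(ℝ, E₁) 𝓘(ℝ, E₂) F p x) (x : TangentSpace 𝓘(ℝ, E₁) p) :
    pullbackConnection E₁ E₂ F (rangeMeanCurvature E₁ E₂ F) p x =
      -a • mfderiv 𝓘(ℝ, E₁) 𝓘(ℝ, E₂) F p x := by
  have hH := hF.cmdiffAlongAt_rangeMeanCurvature hmin p
  have htan (x : TangentSpace 𝓘(ℝ, E₁) p) : (rangeDist E₁ E₂ F p).starProjection
      (pullbackConnection E₁ E₂ F (rangeMeanCurvature E₁ E₂ F) p x) =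
        pullbackConnection E₁ E₂ F (rangeMeanCurvature E₁ E₂ F) p x := by
    have h := hpar p x
    rw [normalConnection, Submodule.starProjection_orthogonal_val, sub_eq_zero] at h
    exact h.symm
  -- By Weingarten `∇_v H` is orthogonal to the range, since the form with a vertical argument is
  -- tangent. It also lies in the range, so it vanishes.
  have hker {v : TangentSpace 𝓘(ℝ, E₁) p} (hv : v ∈ kerDist E₁ E₂ F p) :
      pullbackConnection E₁ E₂ F (rangeMeanCurvature E₁ E₂ F) p v = 0 := by
    obtain ⟨u, hu⟩ := LinearMap.mem_range.1 (Submodule.starProjection_eq_self_iff.1 (htan v))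
    have hu' : mfderiv 𝓘(ℝ, E₁) 𝓘(ℝ, E₂) F p u =
      pullbackConnection E₁ E₂ F (rangeMeanCurvature E₁ E₂ F) p v := hu
    have h := inner_pullbackConnection_rangeMeanCurvature hF.contMDiff hH v u
    rw [secondFundamentalForm_comm hF.contMDiff, (Submodule.mem_orthogonal' _ _).1
      (rangeMeanCurvature_mem_orthogonal p) _ (hF.secondFundamentalForm_mem_rangeDist u hv),
      neg_zero] at h
    exact (inner_self_eq_zero (𝕜 := ℝ)).1 ((congrArg (inner ℝ _) hu').symm.trans h)
  have hhor := ha _ ((kerDist E₁ E₂ F p)ᗮ.starProjection_apply_mem x)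
  rw [shapeOperator, htan, mfderiv_kerDist_orthogonal_starProjection, neg_eq_iff_eq_neg] at hhor
  conv_lhs => rw [← (kerDist E₁ E₂ F p).starProjection_add_starProjection_orthogonal x]
  rw [map_add, hker (Submodule.starProjection_apply_mem _ _), zero_add, hhor, neg_smul]

/-- Trace of the Weingarten relation, using `τ = r H`. The rank stays as a factor because `a` is
unconstrained in rank zero. -/
theorem IsRiemannianMap.finrank_mul_eq (hF : IsRiemannianMap E₁ E₂ F)
    (hmin : IsMinimalDistribution (kerDist E₁ E₂ F)) {a : ℝ}
    (ha : ∀ x, pullbackConnection E₁ E₂ F (rangeMeanCurvature E₁ E₂ F) p x =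
      -a • mfderiv 𝓘(ℝ, E₁) 𝓘(ℝ, E₂) F p x) :
    (Module.finrank ℝ (rangeDist E₁ E₂ F p) : ℝ) * a =
      Module.finrank ℝ (rangeDist E₁ E₂ F p) * ‖rangeMeanCurvature E₁ E₂ F p‖ ^ 2 := by
  let e := stdOrthonormalBasis ℝ (TangentSpace 𝓘(ℝ, E₁) p)
  have h1 : (inner ℝ (rangeMeanCurvature E₁ E₂ F p) (tensionField E₁ E₂ F p) : ℝ) =
      ∑ i, inner ℝ (rangeMeanCurvature E₁ E₂ F p) (secondFundamentalForm E₁ E₂ F p (e i) (e i)) := by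
    rw [tensionField, inner_sum]
  rw [hF.tensionField_eq hmin, real_inner_smul_right, real_inner_self_eq_norm_sq] at h1
  rw [h1, ← hF.sum_inner_mfderiv e, Finset.sum_mul]
  refine Finset.sum_congr rfl fun i _ ↦ ?_
  have h2 := inner_pullbackConnection_rangeMeanCurvature hF.contMDiff
    (hF.cmdiffAlongAt_rangeMeanCurvature hmin p) (e i) (e i)
  rw [ha, real_inner_smul_left] at h2
  linarith

/-- The derivative `2 ⟪∇_x H, H⟫` pairs a tangent vector with a normal one. -/
theorem IsRiemannianMap.norm_rangeMeanCurvature_eq [PreconnectedSpace M₁]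
    (hF : IsRiemannianMap E₁ E₂ F) (hmin : IsMinimalDistribution (kerDist E₁ E₂ F)) {a : M₁ → ℝ}
    (ha : ∀ p x, pullbackConnection E₁ E₂ F (rangeMeanCurvature E₁ E₂ F) p x =
      -a p • mfderiv 𝓘(ℝ, E₁) 𝓘(ℝ, E₂) F p x) (p q : M₁) :
    ‖rangeMeanCurvature E₁ E₂ F p‖ ^ 2 = ‖rangeMeanCurvature E₁ E₂ F q‖ ^ 2 := by
  have hH p := hF.cmdiffAlongAt_rangeMeanCurvature hmin p
  have hloc := IsLocallyConstant.iff_eventually_eq _ |>.2 (eventually_eq_of_mfderiv_eq_zero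
    (fun p ↦ mdifferentiableAt_inner_along ((hH p).mdiffAlongAt one_ne_zero)
      ((hH p).mdiffAlongAt one_ne_zero)) fun p ↦ ?_)
  · simpa only [real_inner_self_eq_norm_sq] using hloc.apply_eq_of_preconnectedSpace p q
  · refine ContinuousLinearMap.ext fun x ↦ ?_
    refine (mvfderiv_inner_along (hH p) (hH p) x).trans ?_
    have horth : (inner ℝ (rangeMeanCurvature E₁ E₂ F p) (mfderiv 𝓘(ℝ, E₁) 𝓘(ℝ, E₂) F p x) : ℝ) = 0 :=
      (Submodule.mem_orthogonal' _ _).1 (rangeMeanCurvature_mem_orthogonal p) _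
        (LinearMap.mem_range_self _ _)
    rw [ha, real_inner_smul_left, real_inner_smul_right, real_inner_comm, horth]
    simp only [mul_zero, add_zero]
    rfl

theorem IsRiemannianMap.finrank_rangeDist_eq [PreconnectedSpace M₁]
    (hF : IsRiemannianMap E₁ E₂ F) (p q : M₁) :
    Module.finrank ℝ (rangeDist E₁ E₂ F p) = Module.finrank ℝ (rangeDist E₁ E₂ F q) :=
  IsLocallyConstant.apply_eq_of_preconnectedSpace
    ((IsLocallyConstant.iff_eventually_eq _).2 hF.eventually_finrank_eq) p q

/-- For constant `a`, each second derivative of `V` is `a` times `∇_e (F_* E) - F_* ∇_e E`, a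
diagonal value of the second fundamental form. -/
theorem laplacianAlong_eq_of_pullbackConnection_eq (hF : ContMDiff 𝓘(ℝ, E₁) 𝓘(ℝ, E₂) ∞ F)
    {V : Π q : M₁, TangentSpace 𝓘(ℝ, E₂) (F q)} {a : ℝ}
    (h : ∀ q x, pullbackConnection E₁ E₂ F V q x = a • mfderiv 𝓘(ℝ, E₁) 𝓘(ℝ, E₂) F q x) (p : M₁) :
    laplacianAlong E₁ E₂ F V p = -a • tensionField E₁ E₂ F p := by
  rw [laplacianAlong, tensionField, neg_smul, Finset.smul_sum]
  refine congrArg _ (Finset.sum_congr rfl fun i _ ↦ ?_)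
  simp only [h]
  have hY := mdiffAlongAt_mfderiv hF (FiberBundle.mdifferentiableAt_extend 𝓘(ℝ, E₁) E₁
    (stdOrthonormalBasis ℝ (TangentSpace 𝓘(ℝ, E₁) p) i))
  rw [pullbackConnection_smul mdifferentiableAt_const hY, mvfderiv_const, secondFundamentalForm,
    smul_sub]
  refine congrArg (· - _) ?_
  exact (congrArg (_ + ·) (zero_smul ℝ _)).trans (add_zero _)

/-- Normality of `v` kills one term of the constant curvature formula; the other sums the `‖F_* e
i‖²`, whose total is the rank. -/
theorem IsRiemannianMap.sum_curvature_eq (hF : IsRiemannianMap E₁ E₂ F) {c : ℝ}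
    (hM₂ : IsSpaceForm E₂ M₂ c) {v : TangentSpace 𝓘(ℝ, E₂) (F p)}
    (hv : v ∈ (rangeDist E₁ E₂ F p)ᗮ) {ι : Type*} [Fintype ι]
    (e : OrthonormalBasis ι ℝ (TangentSpace 𝓘(ℝ, E₁) p)) :
    ∑ i, curvature (F p) (mfderiv 𝓘(ℝ, E₁) 𝓘(ℝ, E₂) F p (e i)) v
        (mfderiv 𝓘(ℝ, E₁) 𝓘(ℝ, E₂) F p (e i)) =
      -(c * Module.finrank ℝ (rangeDist E₁ E₂ F p)) • v := by
  rw [← hF.sum_inner_mfderiv e, Finset.mul_sum, ← Finset.sum_neg_distrib, Finset.sum_smul]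
  refine Finset.sum_congr rfl fun i _ ↦ ?_
  have h0 : (inner ℝ v (mfderiv 𝓘(ℝ, E₁) 𝓘(ℝ, E₂) F p (e i)) : ℝ) = 0 :=
    (Submodule.mem_orthogonal' _ _).1 hv _ (LinearMap.mem_range_self _ _)
  rw [hM₂, h0]
  module

end Biharmonic

end RiemMap

end

/-! ### The dichotomy -/

theorem theorem4p2
    {E₁ : Type*} [NormedAddCommGroup E₁] [NormedSpace ℝ E₁] [FiniteDimensional ℝ E₁]
    {M₁ : Type*} [TopologicalSpace M₁] [ConnectedSpace M₁] [ChartedSpace E₁ M₁]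
    [IsManifold 𝓘(ℝ, E₁) ∞ M₁]
    [RiemannianBundle (fun x : M₁ ↦ TangentSpace 𝓘(ℝ, E₁) x)]
    [IsContMDiffRiemannianBundle 𝓘(ℝ, E₁) ∞ E₁ (fun x : M₁ ↦ TangentSpace 𝓘(ℝ, E₁) x)]
    {E₂ : Type*} [NormedAddCommGroup E₂] [NormedSpace ℝ E₂] [FiniteDimensional ℝ E₂]
    {M₂ : Type*} [TopologicalSpace M₂] [ChartedSpace E₂ M₂] [IsManifold 𝓘(ℝ, E₂) ∞ M₂]
    [RiemannianBundle (fun x : M₂ ↦ TangentSpace 𝓘(ℝ, E₂) x)]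
    [IsContMDiffRiemannianBundle 𝓘(ℝ, E₂) ∞ E₂ (fun x : M₂ ↦ TangentSpace 𝓘(ℝ, E₂) x)]
    (c : ℝ) (hM₂ : RiemMap.IsSpaceForm E₂ M₂ c)
    (F : M₁ → M₂) (hF : RiemMap.IsRiemannianMap E₁ E₂ F)
    (hum : RiemMap.IsPseudoUmbilical E₁ E₂ F)
    (hbi : RiemMap.IsBiharmonicMap E₁ E₂ F)
    (hmin : RiemMap.IsMinimalDistribution (RiemMap.kerDist E₁ E₂ F))
    (hpar : RiemMap.IsParallelRangeMeanCurvature E₁ E₂ F) :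
    RiemMap.IsHarmonicMap E₁ E₂ F ∨
      ∀ p : M₁, c = ‖RiemMap.rangeMeanCurvature E₁ E₂ F p‖ ^ 2 := by
  obtain ⟨lam, -, hlam⟩ := hum
  have hH p x := hF.pullbackConnection_rangeMeanCurvature hmin hpar (hlam p) x
  refine or_iff_not_imp_right.2 fun hc p ↦ ?_
  obtain ⟨o, ho⟩ := not_forall.1 hc
  let k : ℝ := Module.finrank ℝ (RiemMap.rangeDist E₁ E₂ F p)
  let h : ℝ := ‖RiemMap.rangeMeanCurvature E₁ E₂ F p‖ ^ 2
  have hk q : (Module.finrank ℝ (RiemMap.rangeDist E₁ E₂ F q) : ℝ) = k :=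
    congrArg _ (hF.finrank_rangeDist_eq q p)
  have hτ q : RiemMap.tensionField E₁ E₂ F q = k • RiemMap.rangeMeanCurvature E₁ E₂ F q := by
    rw [hF.tensionField_eq hmin, hk]
  -- The coefficient is fixed at `p` yet valid at every `q`, as rank and `‖H‖²` are constant. This
  -- is what permits a second differentiation.
  have hdτ q x : RiemMap.pullbackConnection E₁ E₂ F (RiemMap.tensionField E₁ E₂ F) q x =
      -(k * h) • mfderiv 𝓘(ℝ, E₁) 𝓘(ℝ, E₂) F q x := by
    have h1 := hF.finrank_mul_eq hmin (hH q)
    rw [hk, hF.norm_rangeMeanCurvature_eq hmin hH q p] at h1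
    rw [RiemMap.pullbackConnection_congr (.of_forall hτ), RiemMap.pullbackConnection_smul
      mdifferentiableAt_const ((hF.cmdiffAlongAt_rangeMeanCurvature hmin q).mdiffAlongAt
      one_ne_zero), mvfderiv_const, hH, smul_smul, ← h1, mul_neg]
    exact (congrArg (_ + ·) (zero_smul ℝ _)).trans (add_zero _)
  have hb := hbi p
  have hperp : RiemMap.tensionField E₁ E₂ F p ∈ (RiemMap.rangeDist E₁ E₂ F p)ᗮ :=
    hτ p ▸ Submodule.smul_mem _ _ (RiemMap.rangeMeanCurvature_mem_orthogonal p)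
  rw [RiemMap.bitensionField, RiemMap.laplacianAlong_eq_of_pullbackConnection_eq hF.contMDiff hdτ,
    hF.sum_curvature_eq hM₂ hperp, hk] at hb
  have hb' : (k * (c - h)) • RiemMap.tensionField E₁ E₂ F p = 0 := by
    rw [← hb]
    module
  -- Constancy of `‖H‖²` moves the inequality from the point `o` to `p`.
  rw [hF.norm_rangeMeanCurvature_eq hmin hH o p] at ho
  rcases smul_eq_zero.1 hb' with h0 | h0
  · rw [hτ, (mul_eq_zero.1 h0).resolve_right (sub_ne_zero.2 ho), zero_smul]
  · exact h0
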